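/- Let $d\ge 0$ and $r\ge 0$ be integers (the hypotheses on $\alpha$ below force $r\ge 1$), let $I^d=[0,1]^d\subset\mathbb R^d$ with the Euclidean norm $|\cdot|$ on $\mathbb R^d$, and let $e_i$ be the $i$-th unit coordinate vector. For real-valued $f\in C(I^d)$ put \[ \Delta^r_{h}f(x)=\sum_{k=0}^r(-1)^{r-k}\binom rk f(x+kh),\qquad \omega^r(f,t)=\sup\bigl\{|\Delta^r_h f(x)| : |h|\le t,\ x,\,x+rh\in I^d\bigr\},\qquad \omega=\omega^1, \] and for $n=0,1,2,\dots$ \[ \Psi_r(f,n)=\sup\bigl\{|\Delta^r_{2^{-n}e_i}f(2^{-n}k)| : 1\le i\le d,\ k\in\mathbb Z^d,\ 2^{-n}k,\ 2^{-n}(k+re_i)\in I^d\bigr\}, \] with $\sup\emptyset=0$. In (1), (2) and (4), constants $M$ may depend on $f,r,d,\alpha$, but not on $t$, $x$ or $i$. Then: (1) If $f\in C(I^d)$, $0<\alpha\le r$ and $\Psi_r(f,n)=O(2^{-n\alpha})$ as $n\to\infty$, then there is $M$ such that $|\Delta^r_{te_i}f(x)|\le M t^\alpha$ for all $i$, all $t>0$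 and all $x$ with $x,\ x+rte_i\in I^d$. (2) If $f\in C(I^d)$, $0<\alpha<r$ and $\Psi_r(f,n)=O(2^{-n\alpha})$ as $n\to\infty$, then there is $M$ such that $\omega^r(f,t)\le M t^\alpha$ for all $t>0$. (3) If $d>1$ and $r>1$, the conclusion of (2) can fail for $\alpha=r$: there is $f\in C(I^d)$ with $\Psi_r(f,n)=O(2^{-nr})$ as $n\to\infty$ while $\omega^r(f,t)$ behaves like $t^r|\log t|$, i.e. $c_1t^r|\log t|\le\omega^r(f,t)\le c_2t^r|\log t|$ for some $c_1,c_2>0$ and all sufficiently small $t>0$. (4) If $f\in C(I^d)$, $0<\alpha\le1$ and $\Psi_1(f,n)=O(2^{-n\alpha})$ as $n\to\infty$, then there is $M$ such that $\omega(f,t)\le Mt^\alpha$ for all $t>0$. (5) If $f\in C(I^d)$ and either $0<\alpha<r$, or $r=1$ and $0<\alpha\le 1$, then the following are equivalent: (a) there is $M$ such that \[ \Bigl|\Delta^r_{2^{-n}e_i}f\Bigl(\frac{k_1}{2^n},\dots,\frac{k_d}{2^n}\Bigr)\Bigr|\le M2^{-n\alpha} \] for all integers $n\ge1$, $1\le i\le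 d$, $0\le k_i\le 2^n-r$ and $0\le k_j\le 2^n$ ($j\ne i$); (b) there is $M_1$ such that $|\Delta^r_{he}f(\xi)|\le M_1h^\alpha$ for all $h>0$ and all $\xi,e\in\mathbb R^d$ with $|e|=1$ and $\xi,\ \xi+rhe\in I^d$. -/

import Mathlib

open Filter Topology Asymptotics

noncomputable section

namespace DyadicSmoothness

/-- Euclidean space `ℝ^d`. -/
abbrev Space (d : ℕ) : Type := EuclideanSpace ℝ (Fin d)

/-- The cube `I^d = [0,1]^d`. -/
def cube (d : ℕ) : Set (Space d) := {x | ∀ j, x j ∈ Set.Icc (0 : ℝ) 1}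

/-- The unit vector in the `i`-th coordinate direction. -/
def unitVec {d : ℕ} (i : Fin d) : Space d := EuclideanSpace.single i 1

/-- The `r`-th forward difference
`Δ^r_h f(x) = ∑_{k=0}^r (-1)^(r-k) (r choose k) f(x + k h)`. -/
def diff {d : ℕ} (r : ℕ) (h : Space d) (f : Space d → ℝ) (x : Space d) : ℝ :=
  ∑ k ∈ Finset.range (r + 1),
    (-1 : ℝ) ^ (r - k) * (r.choose k : ℝ) * f (x + (k : ℝ) • h)

/-- The `r`-th difference is the `r`-fold iterate of Mathlib's forward difference. -/
theorem diff_eq_fwdDiff_iter {d : ℕ} (r : ℕ) (h : Space d) (f : Space d → ℝ) (x : Space d) :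
    diff r h f x = (fwdDiff h)^[r] f x := by
  rw [fwdDiff_iter_eq_sum_shift]
  refine Finset.sum_congr rfl fun k _ => ?_
  rw [zsmul_eq_mul, Nat.cast_smul_eq_nsmul]
  push_cast
  rfl

/-- The `r`-th modulus of smoothness
`ω^r(f,t) = sup { |Δ^r_h f(x)| : |h| ≤ t, x ∈ I^d, x + r h ∈ I^d }`. For `f` continuous on the
cube this is the supremum of a bounded set, which is nonempty when `0 ≤ t`. -/
def modulus {d : ℕ} (r : ℕ) (f : Space d → ℝ) (t : ℝ) : ℝ :=
  sSup {v : ℝ | ∃ h x : Space d, ‖h‖ ≤ t ∧ x ∈ cube d ∧ x + (r : ℝ) • h ∈ cube d ∧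
    v = |diff r h f x|}

/-- The mesh width `2^{-n}`. -/
def width (n : ℕ) : ℝ := (2 : ℝ)⁻¹ ^ n

/-- The point `2^{-n} k` of the dyadic mesh, `k ∈ ℤ^d`. -/
def meshPoint {d : ℕ} (n : ℕ) (k : Fin d → ℤ) : Space d :=
  WithLp.toLp 2 fun j => width n * (k j : ℝ)

/-- The discrete `r`-th modulus of smoothness `Ψ_r(f,n)`: the supremum of
`|Δ^r_{2^{-n} e_i} f(2^{-n} k)|` over all `i` and all `k ∈ ℤ^d` with `2^{-n} k ∈ I^d` and
`2^{-n} (k + r e_i) ∈ I^d`. There are finitely many such `i, k`; when there is none,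
the value is `0`. -/
def discreteModulus {d : ℕ} (r : ℕ) (f : Space d → ℝ) (n : ℕ) : ℝ :=
  sSup {v : ℝ | ∃ (i : Fin d) (k : Fin d → ℤ), meshPoint n k ∈ cube d ∧
    meshPoint n k + ((r : ℝ) * width n) • unitVec i ∈ cube d ∧
    v = |diff r (width n • unitVec i) f (meshPoint n k)|}

end DyadicSmoothness

end

/-! Write `ρ = 2^(-α)`, and let `P_{n,x}` be the tensor product Lagrange interpolant of `f` at `r^d`
mesh points of level `n` near `x` (`localPoly`). Its degree is `< r` in each variable, so its `r`-th
differences along the axes vanish, and `f - P_{n,x}` has the same axis differences as `f` and is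
zero at the nodes. Smallness then spreads from the nodes, one coordinate at a time, to all mesh
points at bounded mesh distance (`grid_approx`). Hence `P_{n+1,x} - P_{n,x} = O(ρ^n)` near `x`.
Telescoping in `n` and continuity give `f(y) - P_{n,y}(y) = O(ρ^n)`, so for steps of size at most
`2^(-n)` the `r`-th differences of `f` and of `P_{n,x}` agree up to `O(ρ^n)`
(`exists_seqDiff_approx`).

Along an axis the polynomial contributes nothing, which gives the directional statement up to `α =
r`. In an oblique direction mixed monomials survive. For a step of size `2^(-m)`, the increment
`P_{n+1,x} - P_{n,x}` contributes `O((2^n 2^(-m))^r ρ^n)`, and summing over `n ≤ m` gives a Marchaud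
type bound (`exists_seqDiff_bound`). The sum is geometric with ratio `2^(r-α) > 1` if `α < r`, so
its last term `ρ^m` dominates. If `α = r` all terms are equal and a logarithm appears. If `r = 1`
the interpolants are constants and there is no sum.

The logarithm is attained by `x₀^(r-1) x₁ log (x₀ + x₁)`. Along the axes the singular part `log (x₀
+ x₁)` multiplies polynomials of degree `< r` and drops out, while on the diagonal through the
origin the function is a multiple of `s^r log s`. -/

namespace DyadicSmoothness

/-! ### Differences of sequences and polynomials in one variable. -/

section OneVariable

/-- The `r`-th difference of a sequence at `0`. -/
def seqDiff (r : ℕ) (g : ℕ → ℝ) : ℝ :=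
  ∑ k ∈ Finset.range (r + 1), (-1 : ℝ) ^ (r - k) * (r.choose k : ℝ) * g k

theorem seqDiff_sub (r : ℕ) (g g' : ℕ → ℝ) :
    seqDiff r (fun k => g k - g' k) = seqDiff r g - seqDiff r g' := by
  simp only [seqDiff, mul_sub, Finset.sum_sub_distrib]

theorem seqDiff_add (r : ℕ) (g g' : ℕ → ℝ) :
    seqDiff r (fun k => g k + g' k) = seqDiff r g + seqDiff r g' := by
  simp only [seqDiff, mul_add, Finset.sum_add_distrib]

theorem seqDiff_const_mul (r : ℕ) (c : ℝ) (g : ℕ → ℝ) :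
    seqDiff r (fun k => c * g k) = c * seqDiff r g := by
  simp only [seqDiff, Finset.mul_sum]
  exact Finset.sum_congr rfl fun k _ => by ring

theorem seqDiff_finsetSum {ι : Type*} (s : Finset ι) (r : ℕ) (g : ι → ℕ → ℝ) :
    seqDiff r (fun k => ∑ i ∈ s, g i k) = ∑ i ∈ s, seqDiff r (g i) := by
  simp only [seqDiff, Finset.mul_sum]
  exact Finset.sum_comm

theorem sum_choose_real (r : ℕ) : ∑ k ∈ Finset.range (r + 1), (r.choose k : ℝ) = 2 ^ r := by
  exact_mod_cast Nat.sum_range_choose r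

theorem abs_coeff (r k : ℕ) : |(-1 : ℝ) ^ (r - k) * (r.choose k : ℝ)| = r.choose k := by
  rw [abs_mul, abs_pow, abs_neg, abs_one, one_pow, one_mul, Nat.abs_cast]

theorem abs_seqDiff_le {r : ℕ} {g : ℕ → ℝ} {A : ℝ} (h : ∀ k ≤ r, |g k| ≤ A) :
    |seqDiff r g| ≤ 2 ^ r * A := by
  rw [← sum_choose_real, Finset.sum_mul]
  refine (Finset.abs_sum_le_sum_abs _ _).trans (Finset.sum_le_sum fun k hk => ?_)
  rw [abs_mul, abs_coeff]
  exact mul_le_mul_of_nonneg_left (h k (by simpa [Nat.lt_succ_iff] using hk)) (by positivity)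

/-- The last coefficient of the difference is `1`, and the others have absolute values summing to
`2^r - 1`; solve for the last value. -/
theorem abs_last_le {r : ℕ} {g : ℕ → ℝ} {A : ℝ} (h : ∀ k < r, |g k| ≤ A)
    (h' : |seqDiff r g| ≤ A) : |g r| ≤ 2 ^ r * A := by
  have e : seqDiff r g = ∑ k ∈ Finset.range r, (-1 : ℝ) ^ (r - k) * (r.choose k : ℝ) * g k
      + g r := by
    rw [seqDiff, Finset.sum_range_succ]; simp
  have b : |∑ k ∈ Finset.range r, (-1 : ℝ) ^ (r - k) * (r.choose k : ℝ) * g k|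
      ≤ (2 ^ r - 1) * A := by
    have e2 : (2 : ℝ) ^ r - 1 = ∑ k ∈ Finset.range r, (r.choose k : ℝ) := by
      rw [← sum_choose_real, Finset.sum_range_succ]; simp
    rw [e2, Finset.sum_mul]
    refine (Finset.abs_sum_le_sum_abs _ _).trans (Finset.sum_le_sum fun k hk => ?_)
    rw [abs_mul, abs_coeff]
    exact mul_le_mul_of_nonneg_left (h k (by simpa using hk)) (by positivity)
  have e3 : g r = seqDiff r g - ∑ k ∈ Finset.range r, (-1 : ℝ) ^ (r - k) * (r.choose k : ℝ) * g k := by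
    rw [e]; ring
  rw [e3]
  refine (abs_sub _ _).trans ?_
  linarith

theorem seqDiff_reverse (r : ℕ) (g : ℕ → ℝ) :
    seqDiff r (fun k => g (r - k)) = (-1) ^ r * seqDiff r g := by
  rw [seqDiff, ← Finset.sum_range_reflect, seqDiff, Finset.mul_sum]
  refine Finset.sum_congr rfl fun k hk => ?_
  have hk' : k ≤ r := by simpa [Nat.lt_succ_iff] using hk
  have e1 : r + 1 - 1 - k = r - k := by omega
  have e2 : r - (r - k) = k := by omega
  rw [e1, e2, Nat.choose_symm hk']
  have e3 : (-1 : ℝ) ^ r * (-1) ^ (r - k) = (-1) ^ k := by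
    rw [← pow_add, show r + (r - k) = 2 * (r - k) + k by omega, pow_add, pow_mul]; simp
  rw [← e3]; ring

theorem abs_first_le {r : ℕ} {g : ℕ → ℝ} {A : ℝ} (h : ∀ k ≤ r, 0 < k → |g k| ≤ A)
    (h' : |seqDiff r g| ≤ A) : |g 0| ≤ 2 ^ r * A := by
  have := @abs_last_le r (fun k => g (r - k)) A (fun k hk => h _ (by omega) (by omega))
    (by rw [seqDiff_reverse, abs_mul, abs_pow, abs_neg, abs_one, one_pow, one_mul]; exact h')
  simpa using this

theorem seqDiff_eval {r : ℕ} {p : Polynomial ℝ} (hp : p.natDegree < r) (a b : ℝ) :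
    seqDiff r (fun k => p.eval (a + k * b)) = 0 := by
  set q := p.comp (Polynomial.C a + Polynomial.C b * Polynomial.X) with hq
  have hd : q.natDegree < r := by
    refine lt_of_le_of_lt ?_ hp
    rw [hq, Polynomial.natDegree_comp]
    refine (Nat.mul_le_mul_left _ (?_ : _ ≤ 1)).trans (by simp)
    compute_degree
  have h := congrFun (Polynomial.fwdDiff_iter_eq_zero_of_degree_lt hd) 0
  rw [fwdDiff_iter_eq_sum_shift] at h
  rw [seqDiff]
  refine Eq.trans (Finset.sum_congr rfl fun k _ => ?_) h
  rw [zsmul_eq_mul, hq]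
  simp [mul_comm b]

/-- A function on an integer interval with small `r`-th differences which is small on `r`
consecutive integers is small at bounded distance from them. -/
theorem abs_le_of_seqDiff_le {r : ℕ} {g : ℤ → ℝ} {A : ℝ} {lo hi b : ℤ}
    (hlo : lo ≤ b) (hhi : b + r ≤ hi + 1)
    (hnode : ∀ k, b ≤ k → k < b + r → |g k| ≤ A)
    (hdiff : ∀ k, lo ≤ k → k + r ≤ hi → |seqDiff r (fun j => g (k + j))| ≤ A) (L : ℕ) :
    ∀ k, lo ≤ k → k ≤ hi → b - L ≤ k → k < b + r + L → |g k| ≤ (2 ^ r) ^ L * A := by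
  induction L with
  | zero => intro k h1 h2 h3 h4; simpa using hnode k (by simpa using h3) (by simpa using h4)
  | succ L ih =>
    intro k h1 h2 h3 h4
    push_cast at h3 h4
    -- For `r = 0` the difference is the value itself, so `hdiff` is already the claim.
    rcases Nat.eq_zero_or_pos r with hr | hr
    · subst hr
      have := hdiff k h1 (by simpa using h2)
      simpa [seqDiff] using this
    have hA : 0 ≤ A := (abs_nonneg _).trans (hnode b le_rfl (by omega))
    have h2r : (1 : ℝ) ≤ (2 ^ r) ^ L := one_le_pow₀ (one_le_pow₀ (by norm_num))
    have hAA : A ≤ (2 ^ r) ^ L * A := le_mul_of_one_le_left hA h2r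
    have hmono : (2 ^ r) ^ L * A ≤ (2 ^ r) ^ (L + 1) * A :=
      mul_le_mul_of_nonneg_right (pow_le_pow_right₀ (one_le_pow₀ (by norm_num)) (by omega)) hA
    rw [pow_succ', mul_assoc] at hmono ⊢
    -- A value one place outside the known window is the end term of an `r`-th difference whose
    -- other terms are bounded; each such place costs one factor `2^r`.
    by_cases c1 : k < b - L
    · have := @abs_first_le r (fun j => g (k + j)) ((2 ^ r) ^ L * A)
        (fun j hj hj' => ih _ (by omega) (by omega) (by omega) (by omega))
        ((hdiff k h1 (by omega)).trans hAA)
      simpa using this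
    by_cases c2 : k < b + r + L
    · exact (ih k h1 h2 (by omega) c2).trans hmono
    · have := @abs_last_le r (fun j => g (k - r + j)) ((2 ^ r) ^ L * A)
        (fun j hj => ih _ (by omega) (by omega) (by omega) (by omega))
        ((hdiff (k - r) (by omega) (by omega)).trans hAA)
      simpa using this

/-- The Lagrange basis polynomials for the nodes `0, …, r - 1`. -/
noncomputable def nodeBasis (r a : ℕ) : Polynomial ℝ :=
  Lagrange.basis (Finset.range r) (fun k => (k : ℝ)) a

theorem natDegree_nodeBasis {r a : ℕ} (ha : a < r) : (nodeBasis r a).natDegree < r := by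
  rw [nodeBasis, Lagrange.natDegree_basis (Nat.cast_injective.injOn) (by simpa using ha)]
  simp; omega

theorem eval_nodeBasis {r a c : ℕ} (ha : a < r) (hc : c < r) :
    (nodeBasis r a).eval (c : ℝ) = if a = c then 1 else 0 := by
  split_ifs with h
  · subst h
    exact Lagrange.eval_basis_self (v := fun k : ℕ => (k : ℝ)) (Nat.cast_injective.injOn)
      (by simpa using ha)
  · exact Lagrange.eval_basis_of_ne (v := fun k : ℕ => (k : ℝ)) h (by simpa using hc)

theorem eval_eq_sum_nodeBasis {r : ℕ} {p : Polynomial ℝ} (hp : p.natDegree < r) (t : ℝ) :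
    p.eval t = ∑ a ∈ Finset.range r, p.eval (a : ℝ) * (nodeBasis r a).eval t := by
  have h := Lagrange.eq_interpolate (s := Finset.range r) (v := fun k : ℕ => (k : ℝ)) (f := p)
    (Nat.cast_injective.injOn) (by
      rw [Finset.card_range]
      exact lt_of_le_of_lt Polynomial.degree_le_natDegree (by exact_mod_cast hp))
  conv_lhs => rw [h]
  rw [Lagrange.interpolate_apply, Polynomial.eval_finsetSum]
  simp [nodeBasis]

theorem exists_lipschitz_eval (p : Polynomial ℝ) (R : ℝ) :
    ∃ C, 0 ≤ C ∧ ∀ t s : ℝ, |t| ≤ R → |s| ≤ R → |p.eval s - p.eval t| ≤ C * |s - t| := by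
  obtain ⟨C, hC⟩ := (isCompact_Icc (a := -R) (b := R)).exists_bound_of_continuousOn
    (p.derivative.continuous.continuousOn)
  refine ⟨max C 0, le_max_right _ _, fun t s ht hs => ?_⟩
  have := (convex_Icc (-R) R).norm_image_sub_le_of_norm_hasDerivWithin_le
    (f := fun x => p.eval x) (f' := fun x => p.derivative.eval x) (C := max C 0)
    (fun x _ => (p.hasDerivAt x).hasDerivWithinAt) (fun x hx => (hC x hx).trans (le_max_left _ _))
    (abs_le.1 ht) (abs_le.1 hs)
  simpa [Real.norm_eq_abs] using this

/-- Values and increments of polynomials of degree `< r` are controlled by the values at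
`0, …, r - 1`. -/
theorem exists_poly_bound (r : ℕ) (R : ℝ) :
    ∃ C, 1 ≤ C ∧ ∀ p : Polynomial ℝ, p.natDegree < r → ∀ A, (∀ a < r, |p.eval (a : ℝ)| ≤ A) →
      (∀ t, |t| ≤ R → |p.eval t| ≤ C * A) ∧
      ∀ t s, |t| ≤ R → |s| ≤ R → |p.eval s - p.eval t| ≤ C * |s - t| * A := by
  choose D hD0 hD using fun a => exists_lipschitz_eval (nodeBasis r a) R
  choose E hE using fun a => (isCompact_Icc (a := -R) (b := R)).exists_bound_of_continuousOn
    ((nodeBasis r a).continuous.continuousOn)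
  refine ⟨1 + ∑ a ∈ Finset.range r, (D a + |E a|),
    le_add_of_nonneg_right (Finset.sum_nonneg fun a _ => add_nonneg (hD0 a) (abs_nonneg _)),
    fun p hp A hA => ?_⟩
  have hA0 : 0 ≤ A := (abs_nonneg _).trans (hA 0 (by omega))
  constructor
  · intro t ht
    have h1 : |p.eval t| ≤ ∑ a ∈ Finset.range r, A * |E a| := by
      rw [eval_eq_sum_nodeBasis hp]
      refine (Finset.abs_sum_le_sum_abs _ _).trans (Finset.sum_le_sum fun a ha => ?_)
      rw [abs_mul]
      exact mul_le_mul (hA a (by simpa using ha))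
        ((hE a t (abs_le.1 ht)).trans (le_abs_self _)) (abs_nonneg _) hA0
    refine h1.trans ?_
    rw [← Finset.mul_sum, mul_comm]
    refine mul_le_mul_of_nonneg_right ?_ hA0
    rw [Finset.sum_add_distrib]
    linarith [Finset.sum_nonneg (s := Finset.range r) fun a _ => hD0 a]
  · intro t s ht hs
    have h1 : |p.eval s - p.eval t| ≤ ∑ a ∈ Finset.range r, A * (D a * |s - t|) := by
      rw [eval_eq_sum_nodeBasis hp s, eval_eq_sum_nodeBasis hp t, ← Finset.sum_sub_distrib]
      refine (Finset.abs_sum_le_sum_abs _ _).trans (Finset.sum_le_sum fun a ha => ?_)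
      rw [← mul_sub, abs_mul]
      exact mul_le_mul (hA a (by simpa using ha)) (hD a t s ht hs) (abs_nonneg _) hA0
    refine h1.trans ?_
    rw [← Finset.mul_sum, ← Finset.sum_mul, mul_comm]
    refine mul_le_mul_of_nonneg_right (mul_le_mul_of_nonneg_right ?_ (abs_nonneg _)) hA0
    rw [Finset.sum_add_distrib]
    linarith [Finset.sum_nonneg (s := Finset.range r) fun a _ => abs_nonneg (E a)]

end OneVariable

/-! ### Functions that are polynomials in each variable separately. -/

/-- Coordinatewise extension of bounds from a product of node sets to a product of larger sets. -/
theorem abs_le_of_coordinatewise {d : ℕ} {X : Type*} (u : (Fin d → X) → ℝ) (N B : Fin d → Set X)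
    (hNB : ∀ j, N j ⊆ B j) {C A : ℝ} (hC : 1 ≤ C) (hA : 0 ≤ A)
    (H : ∀ i y, (∀ j, y j ∈ B j) → ∀ A', A ≤ A' →
      (∀ t ∈ N i, |u (Function.update y i t)| ≤ A') → |u y| ≤ C * A')
    (h0 : ∀ y, (∀ j, y j ∈ N j) → |u y| ≤ A) :
    ∀ y, (∀ j, y j ∈ B j) → |u y| ≤ C ^ d * A := by
  -- `S` is the set of coordinates already released from the node sets. Releasing one more costs a
  -- factor `C`, which is why `H` has to accept every `A' ≥ A`.
  have key : ∀ S : Finset (Fin d), ∀ y, (∀ j, y j ∈ B j) → (∀ j, j ∉ S → y j ∈ N j) →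
      |u y| ≤ C ^ S.card * A := by
    intro S
    induction S using Finset.induction_on with
    | empty => intro y _ hy; simpa using h0 y fun j => hy j (by simp)
    | insert i S hi ih =>
      intro y hB hN
      rw [Finset.card_insert_of_notMem hi, pow_succ', mul_assoc]
      refine H i y hB _ (le_mul_of_one_le_left hA (one_le_pow₀ hC)) fun t ht => ih _ ?_ ?_
      · intro j
        by_cases hj : j = i
        · subst hj; simpa using hNB j ht
        · simpa [hj] using hB j
      · intro j hjS
        by_cases hj : j = i
        · subst hj; simpa using ht
        · simpa [hj] using hN j (by simp [hj, hjS])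
  intro y hy
  simpa using key Finset.univ y hy (by simp)

/-- Functions which are polynomials of degree `< r` in each variable separately. -/
def SepPoly {d : ℕ} (r : ℕ) (P : (Fin d → ℝ) → ℝ) : Prop :=
  ∀ i y, ∃ p : Polynomial ℝ, p.natDegree < r ∧ ∀ t, P (Function.update y i t) = p.eval t

variable {d r : ℕ}

theorem SepPoly.sub {P Q : (Fin d → ℝ) → ℝ} (hP : SepPoly r P) (hQ : SepPoly r Q) :
    SepPoly r (fun y => P y - Q y) := by
  intro i y
  obtain ⟨p, hp, hp'⟩ := hP i y
  obtain ⟨q, hq, hq'⟩ := hQ i y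
  exact ⟨p - q, (Polynomial.natDegree_sub_le p q).trans_lt (max_lt hp hq), fun t => by
    simp [hp', hq']⟩

theorem sepPoly_const (hr : 0 < r) (c : ℝ) : SepPoly r (fun _ : Fin d → ℝ => c) :=
  fun _ _ => ⟨Polynomial.C c, by simpa using hr, fun t => by simp⟩

theorem SepPoly.comp_affine {P : (Fin d → ℝ) → ℝ} (hP : SepPoly r P) (c : ℝ) (v : Fin d → ℝ) :
    SepPoly r (fun y => P (fun j => c * y j + v j)) := by
  intro i y
  obtain ⟨p, hp, hp'⟩ := hP i (fun j => c * y j + v j)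
  refine ⟨p.comp (Polynomial.C c * Polynomial.X + Polynomial.C (v i)), ?_, fun t => ?_⟩
  · refine lt_of_le_of_lt ?_ hp
    rw [Polynomial.natDegree_comp]
    refine (Nat.mul_le_mul_left _ (?_ : _ ≤ 1)).trans (by simp)
    compute_degree
  · have e : (fun j => c * Function.update y i t j + v j)
        = Function.update (fun j => c * y j + v j) i (c * t + v i) := by
      ext j
      by_cases hj : j = i
      · subst hj; simp
      · simp [hj]
    show P (fun j => c * Function.update y i t j + v j) = _
    rw [e, hp']; simp

theorem SepPoly.fwdDiff {P : (Fin d → ℝ) → ℝ} (hP : SepPoly r P) (h : Fin d → ℝ) :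
    SepPoly r (fwdDiff h P) := by
  have h1 := (hP.comp_affine 1 h).sub hP
  simp only [one_mul] at h1
  exact h1

theorem SepPoly.fwdDiff_iter {P : (Fin d → ℝ) → ℝ} (hP : SepPoly r P) (h : Fin d → ℝ) (m : ℕ) :
    SepPoly r ((_root_.fwdDiff h)^[m] P) := by
  induction m with
  | zero => simpa using hP
  | succ m ih => rw [Function.iterate_succ_apply']; exact ih.fwdDiff h

theorem fwdDiff_iter_eq_seqDiff (h : Fin d → ℝ) (P : (Fin d → ℝ) → ℝ) (m : ℕ) (x : Fin d → ℝ) :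
    (fwdDiff h)^[m] P x = seqDiff m (fun k => P (x + (k : ℝ) • h)) := by
  rw [fwdDiff_iter_eq_sum_shift]
  refine Finset.sum_congr rfl fun k _ => ?_
  simp only [zsmul_eq_mul, Nat.cast_smul_eq_nsmul]
  push_cast
  rfl

theorem SepPoly.seqDiff_single {P : (Fin d → ℝ) → ℝ} (hP : SepPoly r P) (i : Fin d)
    (y : Fin d → ℝ) (s : ℝ) :
    seqDiff r (fun k => P (y + (k : ℝ) • Pi.single i s)) = 0 := by
  obtain ⟨p, hp, hp'⟩ := hP i y
  rw [← seqDiff_eval hp (y i) s]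
  congr 1
  ext k
  rw [← hp']
  congr 1
  ext j
  by_cases hj : j = i
  · subst hj; simp
  · simp [hj]

theorem SepPoly.bound_unit (d : ℕ) (hr : 0 < r) (R : ℝ) :
    ∃ C, 1 ≤ C ∧ ∀ P : (Fin d → ℝ) → ℝ, SepPoly r P → ∀ A,
      (∀ a : Fin d → ℕ, (∀ j, a j < r) → |P (fun j => (a j : ℝ))| ≤ A) →
      ∀ y, (∀ j, |y j| ≤ R) → |P y| ≤ C * A := by
  -- The radius is enlarged to `max R r` so that the box contains the nodes.
  obtain ⟨C, hC, h⟩ := exists_poly_bound r (max R r)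
  refine ⟨C ^ d, one_le_pow₀ hC, fun P hP A hA y hy => ?_⟩
  refine abs_le_of_coordinatewise P (fun _ => {t | ∃ a : ℕ, a < r ∧ t = a})
    (fun _ => {t | |t| ≤ max R r}) ?_ hC ((abs_nonneg _).trans (hA (fun _ => 0) fun _ => hr))
    ?_ ?_ y fun j => (hy j).trans (le_max_left _ _)
  · rintro j t ⟨a, ha, rfl⟩
    simp only [Set.mem_ofPred_eq, Nat.abs_cast]
    exact le_max_of_le_right (by exact_mod_cast ha.le)
  · intro i y hy A' _ hA'
    obtain ⟨p, hp, hp'⟩ := hP i y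
    have := (h p hp A' fun a ha => by rw [← hp']; exact hA' _ ⟨a, ha, rfl⟩).1 (y i) (hy i)
    rwa [← hp', Function.update_eq_self] at this
  · intro y hy
    choose a ha ha' using hy
    have := hA a ha
    rwa [show (fun j => (a j : ℝ)) = y from funext fun j => (ha' j).symm] at this

/-- A difference with step of size `δ` gains a factor `δ`: move one coordinate at a time and use the
increment bound in one variable. Since `fwdDiff h P` is again separately polynomial and is again
bounded at the nodes, the estimate can be iterated. -/
theorem SepPoly.fwdDiff_unit (d : ℕ) (hr : 0 < r) :
    ∃ C, 1 ≤ C ∧ ∀ P : (Fin d → ℝ) → ℝ, SepPoly r P → ∀ A,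
      (∀ a : Fin d → ℕ, (∀ j, a j < r) → |P (fun j => (a j : ℝ))| ≤ A) →
      ∀ (h : Fin d → ℝ) (δ : ℝ), δ ≤ 1 → (∀ j, |h j| ≤ δ) → 0 ≤ δ →
      ∀ a : Fin d → ℕ, (∀ j, a j < r) → |_root_.fwdDiff h P (fun j => (a j : ℝ))| ≤ C * δ * A := by
  obtain ⟨C₁, hC₁, h₁⟩ := SepPoly.bound_unit d hr ((r : ℝ) + 1)
  obtain ⟨C₂, hC₂, h₂⟩ := exists_poly_bound r ((r : ℝ) + 1)
  have h12 : 1 ≤ C₂ * C₁ := one_le_mul_of_one_le_of_one_le hC₂ hC₁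
  have hd1 : (1 : ℝ) ≤ d + 1 := by linarith [Nat.cast_nonneg (α := ℝ) d]
  -- `d + 1` instead of `d` keeps the constant at least `1` when `d = 0`.
  refine ⟨(d + 1) * (C₂ * C₁), one_le_mul_of_one_le_of_one_le hd1 h12,
    fun P hP A hA h δ hδ hhδ hδ0 a ha => ?_⟩
  have hA0 : 0 ≤ A := (abs_nonneg _).trans (hA (fun _ => 0) fun _ => hr)
  set z : Fin d → ℝ := fun j => (a j : ℝ) with hz
  have hzr : ∀ j, |z j| ≤ r := fun j => by
    rw [hz, Nat.abs_cast]; exact_mod_cast (ha j).le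
  have key : ∀ S : Finset (Fin d),
      |P (fun j => if j ∈ S then z j + h j else z j) - P z| ≤ S.card * (C₂ * C₁ * δ * A) := by
    intro S
    induction S using Finset.induction_on with
    | empty => simp
    | insert i S hi ih =>
      set w : Fin d → ℝ := fun j => if j ∈ S then z j + h j else z j with hw
      have hwr : ∀ j, |w j| ≤ (r : ℝ) + 1 := fun j => by
        simp only [hw]
        split_ifs
        · exact (abs_add_le _ _).trans (add_le_add (hzr j) ((hhδ j).trans hδ))
        · exact (hzr j).trans (by linarith)
      have hwi : w i = z i := by simp [hw, hi]
      have e : (fun j => if j ∈ insert i S then z j + h j else z j)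
          = Function.update w i (z i + h i) := by
        ext j
        by_cases hj : j = i
        · subst hj; simp
        · simp [hj, hw]
      obtain ⟨p, hp, hp'⟩ := hP i w
      have hb : ∀ c < r, |p.eval (c : ℝ)| ≤ C₁ * A := fun c hc => by
        rw [← hp']
        refine h₁ P hP A hA _ fun j => ?_
        by_cases hj : j = i
        · subst hj
          simp only [Function.update_self, Nat.abs_cast]
          have : (c : ℝ) ≤ r := by exact_mod_cast hc.le
          linarith
        · simpa [hj] using hwr j
      have h3 := (h₂ p hp _ hb).2 (z i) (z i + h i) ((hzr i).trans (by linarith))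
        ((abs_add_le _ _).trans (add_le_add (hzr i) ((hhδ i).trans hδ)))
      rw [← hp', ← hp', ← e, ← hwi, Function.update_eq_self, hwi, add_sub_cancel_left] at h3
      have h4 : C₂ * |h i| * (C₁ * A) ≤ C₂ * C₁ * δ * A := by
        calc C₂ * |h i| * (C₁ * A) = C₂ * C₁ * |h i| * A := by ring
          _ ≤ _ := by gcongr; exact hhδ i
      rw [Finset.card_insert_of_notMem hi]
      push_cast
      calc _ ≤ _ := abs_sub_le _ (P w) _
        _ ≤ _ := add_le_add (h3.trans h4) ih
        _ = _ := by ring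
  have := key Finset.univ
  simp only [Finset.mem_univ, if_true, Finset.card_univ, Fintype.card_fin] at this
  rw [_root_.fwdDiff]
  refine this.trans ?_
  have : 0 ≤ C₂ * C₁ * δ * A := by positivity
  nlinarith

/-! ### Rescaling to the dyadic mesh, and tensor product interpolation. -/

/-- The dyadic mesh in `ℝ^d` as a plain function space. -/
noncomputable def mesh (n : ℕ) (k : Fin d → ℤ) : Fin d → ℝ := fun j => width n * (k j : ℝ)

theorem width_pos (n : ℕ) : 0 < width n := by unfold width; positivity

theorem width_le_one (n : ℕ) : width n ≤ 1 := pow_le_one₀ (by norm_num) (by norm_num)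

theorem two_pow_mul_width (n : ℕ) : (2 : ℝ) ^ n * width n = 1 := by
  rw [width, inv_pow, mul_inv_cancel₀ (by positivity)]

/-- `|P| ≤ A` at the `r^d` mesh points of level `n` starting with `b`. -/
def NodeBound (r n : ℕ) (b : Fin d → ℤ) (P : (Fin d → ℝ) → ℝ) (A : ℝ) : Prop :=
  ∀ a : Fin d → ℕ, (∀ j, a j < r) → |P (mesh n (fun j => b j + a j))| ≤ A

theorem NodeBound.rescale {n : ℕ} {b : Fin d → ℤ} {P : (Fin d → ℝ) → ℝ} {A : ℝ}
    (h : NodeBound r n b P A) (a : Fin d → ℕ) (ha : ∀ j, a j < r) :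
    |P (fun j => width n * (a j : ℝ) + width n * (b j : ℝ))| ≤ A := by
  refine le_of_eq_of_le ?_ (h a ha)
  congr 2
  ext j
  simp [mesh]; ring

theorem SepPoly.bound (d : ℕ) (hr : 0 < r) (R : ℝ) :
    ∃ C, 1 ≤ C ∧ ∀ P : (Fin d → ℝ) → ℝ, SepPoly r P → ∀ n b A, NodeBound r n b P A →
      ∀ y : Fin d → ℝ, (∀ j, |2 ^ n * y j - b j| ≤ R) → |P y| ≤ C * A := by
  obtain ⟨C, hC, h⟩ := SepPoly.bound_unit d hr R
  refine ⟨C, hC, fun P hP n b A hA y hy => ?_⟩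
  have := h _ (hP.comp_affine (width n) (fun j => width n * b j)) A hA.rescale _ hy
  refine le_of_eq_of_le ?_ this
  congr 2
  ext j
  linear_combination (-y j) * two_pow_mul_width n

/-- Scaling the mesh of level `n` to the integers turns `h` into `2^n h`, and each of the `r`
differences gains `2^n δ`. In oblique directions nothing better than this power gain is available,
because mixed monomials of total degree at least `r` survive. -/
theorem SepPoly.seqDiff_bound (d : ℕ) (hr : 0 < r) (R : ℝ) :
    ∃ C, 1 ≤ C ∧ ∀ P : (Fin d → ℝ) → ℝ, SepPoly r P → ∀ n b A, NodeBound r n b P A →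
      ∀ (h : Fin d → ℝ) (δ : ℝ), 0 ≤ δ → δ ≤ width n → (∀ j, |h j| ≤ δ) →
      ∀ y : Fin d → ℝ, (∀ j, |2 ^ n * y j - b j| ≤ R) →
      |seqDiff r (fun k => P (y + (k : ℝ) • h))| ≤ C * (2 ^ n * δ) ^ r * A := by
  obtain ⟨C₁, hC₁, h₁⟩ := SepPoly.bound_unit d hr R
  obtain ⟨C₂, hC₂, h₂⟩ := SepPoly.fwdDiff_unit d hr
  refine ⟨C₁ * C₂ ^ r, one_le_mul_of_one_le_of_one_le hC₁ (one_le_pow₀ hC₂),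
    fun P hP n b A hA h δ hδ0 hδ hhδ y hy => ?_⟩
  set Q : (Fin d → ℝ) → ℝ := fun z => P (fun j => width n * z j + width n * b j) with hQ
  have hQp : SepPoly r Q := hP.comp_affine (width n) (fun j => width n * b j)
  have h2n : (0 : ℝ) < 2 ^ n := by positivity
  have hit : ∀ m, ∀ a : Fin d → ℕ, (∀ j, a j < r) →
      |(_root_.fwdDiff ((2 : ℝ) ^ n • h))^[m] Q (fun j => (a j : ℝ))|
        ≤ (C₂ * (2 ^ n * δ)) ^ m * A := by
    intro m
    induction m with
    | zero => intro a ha; simpa using hA.rescale a ha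
    | succ m ih =>
      intro a ha
      rw [Function.iterate_succ_apply', pow_succ', mul_assoc]
      refine h₂ _ (hQp.fwdDiff_iter _ m) _ ih _ (2 ^ n * δ) ?_ ?_ (by positivity) a ha
      · rw [← two_pow_mul_width n]; gcongr
      · intro j
        rw [Pi.smul_apply, smul_eq_mul, abs_mul, abs_of_pos h2n]
        exact mul_le_mul_of_nonneg_left (hhδ j) h2n.le
  have := h₁ _ (hQp.fwdDiff_iter _ r) _ (hit r) _ hy
  rw [fwdDiff_iter_eq_seqDiff, mul_pow] at this
  refine le_of_eq_of_le ?_ (this.trans (le_of_eq (by ring)))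
  congr 3
  ext k
  simp only [hQ]
  congr 1
  ext j
  simp only [Pi.add_apply, Pi.smul_apply, smul_eq_mul]
  linear_combination (-y j - k * h j) * two_pow_mul_width n

/-- The tensor product Lagrange interpolant of `F` at the `r^d` mesh points of level `n` starting
with `b`. -/
noncomputable def meshInterp (r : ℕ) (F : (Fin d → ℝ) → ℝ) (n : ℕ) (b : Fin d → ℤ) :
    (Fin d → ℝ) → ℝ := fun y =>
  ∑ a ∈ Fintype.piFinset fun _ : Fin d => Finset.range r,
    F (mesh n (fun j => b j + a j)) * ∏ j, (nodeBasis r (a j)).eval (2 ^ n * y j - b j)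

theorem sepPoly_meshInterp (hr : 0 < r) (F : (Fin d → ℝ) → ℝ) (n : ℕ) (b : Fin d → ℤ) :
    SepPoly r (meshInterp r F n b) := by
  have hU : SepPoly r (fun y => ∑ a ∈ Fintype.piFinset fun _ : Fin d => Finset.range r,
      F (mesh n (fun j => b j + a j)) * ∏ j, (nodeBasis r (a j)).eval (y j)) := by
    intro i y
    refine ⟨∑ a ∈ Fintype.piFinset fun _ : Fin d => Finset.range r,
      Polynomial.C (F (mesh n (fun j => b j + a j)) *
        ∏ j ∈ Finset.univ.erase i, (nodeBasis r (a j)).eval (y j)) * nodeBasis r (a i), ?_, ?_⟩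
    · refine lt_of_le_of_lt (Polynomial.natDegree_sum_le_of_forall_le (n := r - 1) _ _ ?_)
        (by omega)
      intro a ha
      refine (Polynomial.natDegree_C_mul_le _ _).trans ?_
      have := natDegree_nodeBasis (Finset.mem_range.1 (Fintype.mem_piFinset.1 ha i))
      omega
    · intro t
      rw [Polynomial.eval_finsetSum]
      refine Finset.sum_congr rfl fun a _ => ?_
      rw [← Finset.prod_erase_mul _ _ (Finset.mem_univ i), Function.update_self,
        Polynomial.eval_mul, Polynomial.eval_C, mul_assoc]
      congr 2
      refine Finset.prod_congr rfl fun j hj => ?_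
      rw [Function.update_of_ne (Finset.ne_of_mem_erase hj)]
  have := hU.comp_affine (2 ^ n) (fun j => -(b j : ℝ))
  simp only [← sub_eq_add_neg] at this
  exact this

theorem meshInterp_node (F : (Fin d → ℝ) → ℝ) (n : ℕ) (b : Fin d → ℤ) (a : Fin d → ℕ)
    (ha : ∀ j, a j < r) :
    meshInterp r F n b (mesh n (fun j => b j + a j)) = F (mesh n (fun j => b j + a j)) := by
  rw [meshInterp, Finset.sum_eq_single a]
  · rw [Finset.prod_eq_one, mul_one]
    intro j _
    have : (2 : ℝ) ^ n * mesh n (fun j => b j + (a j : ℤ)) j - b j = a j := by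
      simp only [mesh]; push_cast
      linear_combination ((b j : ℝ) + a j) * two_pow_mul_width n
    rw [this, eval_nodeBasis (ha j) (ha j), if_pos rfl]
  · intro c hc hca
    obtain ⟨j, hj⟩ := Function.ne_iff.1 hca
    rw [Finset.prod_eq_zero (Finset.mem_univ j), mul_zero]
    have : (2 : ℝ) ^ n * mesh n (fun j => b j + (a j : ℤ)) j - b j = a j := by
      simp only [mesh]; push_cast
      linear_combination ((b j : ℝ) + a j) * two_pow_mul_width n
    rw [this, eval_nodeBasis (Finset.mem_range.1 (Fintype.mem_piFinset.1 hc j)) (ha j), if_neg hj]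
  · intro h
    exact absurd (Fintype.mem_piFinset.2 fun j => Finset.mem_range.2 (ha j)) h

/-! ### Approximation at mesh points of one level. -/

/-- The unit cube as a set of plain functions. -/
def unitBox (d : ℕ) : Set (Fin d → ℝ) := {x | ∀ j, x j ∈ Set.Icc (0 : ℝ) 1}

/-- `|Δ^r_{2^{-n} e_i} F| ≤ ε n` at the mesh points of all levels `n ≥ N`. -/
def DyadicBound (r : ℕ) (F : (Fin d → ℝ) → ℝ) (N : ℕ) (ε : ℕ → ℝ) : Prop :=
  ∀ n, N ≤ n → ∀ (i : Fin d) (k : Fin d → ℤ), (∀ j, 0 ≤ k j ∧ k j ≤ 2 ^ n) → k i + r ≤ 2 ^ n →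
    |seqDiff r (fun l => F (mesh n k + (l : ℝ) • Pi.single i (width n)))| ≤ ε n

theorem add_smul_mem_unitBox {x h : Fin d → ℝ} (hx : x ∈ unitBox d)
    (hxh : x + (r : ℝ) • h ∈ unitBox d) {k : ℕ} (hk : k ≤ r) : x + (k : ℝ) • h ∈ unitBox d := by
  intro j
  have h1 := hx j
  have h2 := hxh j
  simp only [Pi.add_apply, Pi.smul_apply, smul_eq_mul, Set.mem_Icc] at h1 h2 ⊢
  have hk' : (k : ℝ) ≤ r := by exact_mod_cast hk
  have hk0 : (0 : ℝ) ≤ k := by positivity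
  rcases le_total 0 (h j) with h0 | h0
  · constructor
    · nlinarith
    · nlinarith
  · constructor
    · nlinarith
    · nlinarith

theorem mesh_update_add (n : ℕ) (k : Fin d → ℤ) (i : Fin d) (t : ℤ) (l : ℕ) :
    mesh n (Function.update k i (t + l))
      = mesh n (Function.update k i t) + (l : ℝ) • Pi.single i (width n) := by
  ext j
  by_cases hj : j = i
  · subst hj; simp [mesh]; ring
  · simp [mesh, hj]

/-- `F - P` vanishes at the nodes, and its axis differences equal those of `F` because `P` has
degree `< r` in each variable. `abs_le_of_seqDiff_le` spreads this along one axis, and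
`abs_le_of_coordinatewise` combines the axes. -/
theorem grid_approx (hr : 0 < r) {F P : (Fin d → ℝ) → ℝ} (hP : SepPoly r P) {N n : ℕ}
    {ε : ℕ → ℝ} (hF : DyadicBound r F N ε) (hn : N ≤ n) (hε : 0 ≤ ε n) {b : Fin d → ℤ}
    (hb : ∀ j, 0 ≤ b j ∧ b j + r ≤ 2 ^ n)
    (hPF : ∀ a : Fin d → ℕ, (∀ j, a j < r) →
      P (mesh n (fun j => b j + a j)) = F (mesh n (fun j => b j + a j))) (L : ℕ)
    (k : Fin d → ℤ) (hk : ∀ j, 0 ≤ k j ∧ k j ≤ 2 ^ n) (hkb : ∀ j, |k j - b j| ≤ L) :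
    |F (mesh n k) - P (mesh n k)| ≤ ((2 ^ r) ^ L) ^ d * ε n := by
  refine abs_le_of_coordinatewise (fun k => F (mesh n k) - P (mesh n k))
    (fun j => {t | b j ≤ t ∧ t < b j + r})
    (fun j => {t | 0 ≤ t ∧ t ≤ 2 ^ n ∧ b j - L ≤ t ∧ t < b j + r + L}) ?_
    (one_le_pow₀ (one_le_pow₀ (by norm_num))) hε ?_ ?_ k ?_
  · rintro j t ⟨h1, h2⟩
    have := hb j
    refine ⟨?_, ?_, ?_, ?_⟩ <;> omega
  · intro i y hy A' hA' hN
    have h1 := abs_le_of_seqDiff_le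
      (g := fun t => F (mesh n (Function.update y i t)) - P (mesh n (Function.update y i t)))
      (r := r) (A := A') (lo := 0) (hi := 2 ^ n) (b := b i) (hb i).1 (by have := hb i; omega)
      (fun t h1 h2 => hN t ⟨h1, h2⟩) ?_ L (y i) (hy i).1 (hy i).2.1 (hy i).2.2.1 (hy i).2.2.2
    · simpa using h1
    · intro t ht ht'
      simp only [mesh_update_add]
      rw [seqDiff_sub, hP.seqDiff_single, sub_zero]
      refine (hF n hn i _ ?_ (by simpa using ht')).trans hA'
      intro j
      by_cases hj : j = i
      · subst hj; simp only [Function.update_self]; omega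
      · simp only [Function.update_of_ne hj]; exact ⟨(hy j).1, (hy j).2.1⟩
  · intro y hy
    have := hPF (fun j => (y j - b j).toNat) fun j => by have := hy j; simp at this; omega
    have e : (fun j => b j + ((y j - b j).toNat : ℤ)) = y := by
      ext j; have := hy j; simp at this; omega
    rw [e] at this
    simpa [this] using hε
  · intro j
    have h1 := abs_le.1 (hkb j)
    have h2 := hk j
    refine ⟨h2.1, h2.2, ?_, ?_⟩ <;> omega

/-! ### Local interpolants and their comparison across levels and base points. -/

/-- The lowest corner of the interpolation nodes of level `n` used near `x`. -/
noncomputable def baseNode (r n : ℕ) (x : Fin d → ℝ) : Fin d → ℤ :=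
  fun j => min ⌊2 ^ n * x j⌋ (2 ^ n - r)

theorem baseNode_mem {n : ℕ} (hn : r ≤ 2 ^ n) {x : Fin d → ℝ} (hx : x ∈ unitBox d) (j : Fin d) :
    0 ≤ baseNode r n x j ∧ baseNode r n x j + r ≤ 2 ^ n := by
  have h1 : 0 ≤ ⌊2 ^ n * x j⌋ := Int.floor_nonneg.2 (mul_nonneg (by positivity) (hx j).1)
  have h2 : (r : ℤ) ≤ 2 ^ n := by exact_mod_cast hn
  simp only [baseNode]
  omega

/-- Near the upper faces the minimum in `baseNode` moves the window of nodes inward, so `x` can be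
up to `r` mesh widths from its corner. -/
theorem baseNode_near (hr : 0 < r) (n : ℕ) {x : Fin d → ℝ} (hx : x ∈ unitBox d) (j : Fin d) :
    0 ≤ 2 ^ n * x j - baseNode r n x j ∧ 2 ^ n * x j - baseNode r n x j ≤ r := by
  have h1 := Int.floor_le (2 ^ n * x j)
  have h2 := Int.lt_floor_add_one (2 ^ n * x j)
  have h3 : (2 : ℝ) ^ n * x j ≤ 2 ^ n := mul_le_of_le_one_right (by positivity) (hx j).2
  have hr' : (1 : ℝ) ≤ r := by exact_mod_cast hr
  simp only [baseNode]
  push_cast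
  rcases min_cases ((⌊2 ^ n * x j⌋ : ℤ) : ℝ) (2 ^ n - (r : ℝ)) with h | h <;>
  · rw [h.1]; constructor <;> linarith

/-- The interpolating polynomial of `F` at level `n` near `x`. -/
noncomputable def localPoly (r : ℕ) (F : (Fin d → ℝ) → ℝ) (n : ℕ) (x : Fin d → ℝ) :
    (Fin d → ℝ) → ℝ := meshInterp r F n (baseNode r n x)

theorem sepPoly_localPoly (hr : 0 < r) (F : (Fin d → ℝ) → ℝ) (n : ℕ) (x : Fin d → ℝ) :
    SepPoly r (localPoly r F n x) := sepPoly_meshInterp hr F n _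

theorem localPoly_node (F : (Fin d → ℝ) → ℝ) (n : ℕ) (x : Fin d → ℝ) (a : Fin d → ℕ)
    (ha : ∀ j, a j < r) : localPoly r F n x (mesh n (fun j => baseNode r n x j + a j))
      = F (mesh n (fun j => baseNode r n x j + a j)) := meshInterp_node F n _ a ha

theorem mesh_mem_unitBox {n : ℕ} {k : Fin d → ℤ} (hk : ∀ j, 0 ≤ k j ∧ k j ≤ 2 ^ n) :
    mesh n k ∈ unitBox d := by
  intro j
  have h1 : (0 : ℝ) ≤ k j := by exact_mod_cast (hk j).1
  have h2 : (k j : ℝ) ≤ 2 ^ n := by exact_mod_cast (hk j).2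
  refine ⟨mul_nonneg (width_pos n).le h1, ?_⟩
  rw [← two_pow_mul_width n]
  simp only [mesh]
  rw [mul_comm]
  exact mul_le_mul_of_nonneg_right h2 (width_pos n).le

theorem mesh_succ (n : ℕ) (k : Fin d → ℤ) : mesh n k = mesh (n + 1) (fun j => 2 * k j) := by
  ext j
  simp only [mesh, width, pow_succ]
  push_cast
  ring

/-- Nodes of level `n` are mesh points of level `n + 1`, and there the level `n` interpolant equals
`F`. The difference is thus the error of the finer interpolant, which `grid_approx` bounds. The
distance `3 * r` allows for the doubled index, the node offset and the position of `x` in its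
window. -/
theorem nodeBound_localPoly_succ (hr : 0 < r) {F : (Fin d → ℝ) → ℝ} {N n : ℕ} {ε : ℕ → ℝ}
    (hF : DyadicBound r F N ε) (hn : N ≤ n + 1) (hrn : r ≤ 2 ^ n) (hε : 0 ≤ ε (n + 1))
    {x : Fin d → ℝ} (hx : x ∈ unitBox d) :
    NodeBound r n (baseNode r n x) (fun y => localPoly r F (n + 1) x y - localPoly r F n x y)
      (((2 ^ r) ^ (3 * r)) ^ d * ε (n + 1)) := by
  intro a ha
  have hrn' : r ≤ 2 ^ (n + 1) := hrn.trans (Nat.pow_le_pow_right (by norm_num) (by omega))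
  simp only [localPoly_node F n x a ha]
  rw [abs_sub_comm, mesh_succ]
  refine grid_approx hr (sepPoly_localPoly hr F _ x) hF hn hε
    (b := baseNode r (n + 1) x) (baseNode_mem hrn' hx) (localPoly_node F (n + 1) x) (3 * r) _ ?_ ?_
  · intro j
    have h1 := baseNode_mem hrn hx j
    have h2 := ha j
    rw [pow_succ]
    constructor <;> omega
  · intro j
    have h1 := baseNode_near hr n hx j
    have h2 := baseNode_near hr (n + 1) hx j
    have h3 : (a j : ℝ) + 1 ≤ r := by exact_mod_cast ha j
    have h4 : (0 : ℝ) ≤ a j := by positivity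
    rw [pow_succ] at h2
    have : |2 * ((baseNode r n x j : ℝ) + a j) - baseNode r (n + 1) x j| ≤ 3 * r := by
      rw [abs_le]; constructor <;> nlinarith
    exact_mod_cast this

/-- The same argument within one level: at the nodes of `x` the interpolant of `x` equals `F`, so
only the error of the interpolant of `y` remains. -/
theorem nodeBound_localPoly_sub (hr : 0 < r) {F : (Fin d → ℝ) → ℝ} {N n : ℕ} {ε : ℕ → ℝ}
    (hF : DyadicBound r F N ε) (hn : N ≤ n) (hrn : r ≤ 2 ^ n) (hε : 0 ≤ ε n)
    {x y : Fin d → ℝ} (hx : x ∈ unitBox d) (hy : y ∈ unitBox d)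
    (hxy : ∀ j, 2 ^ n * |y j - x j| ≤ r) :
    NodeBound r n (baseNode r n x) (fun z => localPoly r F n y z - localPoly r F n x z)
      (((2 ^ r) ^ (3 * r)) ^ d * ε n) := by
  intro a ha
  simp only [localPoly_node F n x a ha]
  rw [abs_sub_comm]
  refine grid_approx hr (sepPoly_localPoly hr F _ y) hF hn hε
    (b := baseNode r n y) (baseNode_mem hrn hy) (localPoly_node F n y) (3 * r) _ ?_ ?_
  · intro j
    have h1 := baseNode_mem hrn hx j
    have h2 := ha j
    constructor <;> omega
  · intro j
    have h1 := baseNode_near hr n hx j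
    have h2 := baseNode_near hr n hy j
    have h3 : (a j : ℝ) + 1 ≤ r := by exact_mod_cast ha j
    have h4 : (0 : ℝ) ≤ a j := by positivity
    have h5 := hxy j
    rw [← abs_of_pos (show (0 : ℝ) < 2 ^ n by positivity), ← abs_mul, abs_le, mul_sub] at h5
    have : |((baseNode r n x j : ℝ) + a j) - baseNode r n y j| ≤ 3 * r := by
      rw [abs_le]; constructor <;> linarith
    exact_mod_cast this

theorem abs_mesh_sub_le (hr : 0 < r) {n : ℕ} {y : Fin d → ℝ} (hy : y ∈ unitBox d) (a : Fin d → ℕ)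
    (ha : ∀ j, a j < r) (j : Fin d) :
    |mesh n (fun j => baseNode r n y j + a j) j - y j| ≤ r * width n := by
  have h1 := baseNode_near hr n hy j
  have h3 : (a j : ℝ) + 1 ≤ r := by exact_mod_cast ha j
  have h4 : (0 : ℝ) ≤ a j := by positivity
  have e : mesh n (fun j => baseNode r n y j + a j) j - y j
      = ((baseNode r n y j : ℝ) + a j - 2 ^ n * y j) * width n := by
    simp only [mesh]; push_cast
    linear_combination (y j) * two_pow_mul_width n
  rw [e, abs_mul, abs_of_pos (width_pos n)]
  refine mul_le_mul_of_nonneg_right ?_ (width_pos n).le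
  rw [abs_le]; constructor <;> linarith

/-! ### Passage to the limit and summation over levels. -/

theorem tendsto_width : Tendsto width atTop (𝓝 0) :=
  tendsto_pow_atTop_nhds_zero_of_lt_one (by norm_num) (by norm_num)

/-- The dyadic hypothesis sees only mesh points; continuity carries it to all `y`. The nodes tend to
`y`, so the polynomial minus the constant `F y` is small at the nodes, hence also at `y`. -/
theorem tendsto_localPoly (hr : 0 < r) {F : (Fin d → ℝ) → ℝ} (hF : ContinuousOn F (unitBox d))
    {y : Fin d → ℝ} (hy : y ∈ unitBox d) :
    Tendsto (fun n => localPoly r F n y y) atTop (𝓝 (F y)) := by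
  obtain ⟨C, hC, hb⟩ := SepPoly.bound d hr (r : ℝ)
  rw [Metric.tendsto_atTop]
  intro ε hε
  have hCp : 0 < C := by linarith
  obtain ⟨δ, hδ, hδ'⟩ := Metric.continuousOn_iff.1 hF y hy (ε / (2 * C)) (by positivity)
  have h1 : ∀ᶠ n in atTop, (r : ℝ) * width n < δ := by
    have := tendsto_width.const_mul (r : ℝ)
    rw [mul_zero] at this
    exact this.eventually_lt_const hδ
  have h2 : ∀ᶠ n : ℕ in atTop, r ≤ 2 ^ n :=
    (tendsto_pow_atTop_atTop_of_one_lt (by norm_num : 1 < 2)).eventually_ge_atTop r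
  obtain ⟨N, hN⟩ := eventually_atTop.1 (h1.and h2)
  refine ⟨N, fun n hn => ?_⟩
  obtain ⟨h3, h4⟩ := hN n hn
  have hnb : NodeBound r n (baseNode r n y) (fun z => localPoly r F n y z - F y)
      (ε / (2 * C)) := by
    intro a ha
    simp only [localPoly_node F n y a ha]
    rw [← Real.dist_eq]
    refine (hδ' _ (mesh_mem_unitBox fun j => ?_) ?_).le
    · have := baseNode_mem h4 hy j
      have := ha j
      constructor <;> omega
    · rw [dist_pi_lt_iff hδ]
      intro j
      rw [Real.dist_eq]
      exact (abs_mesh_sub_le hr hy a ha j).trans_lt h3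
  have := hb _ ((sepPoly_localPoly hr F n y).sub (sepPoly_const hr (F y))) n _ _ hnb y fun j => by
    have := baseNode_near hr n hy j
    rw [abs_le]; constructor <;> linarith
  rw [Real.dist_eq]
  refine this.trans_lt ?_
  have : C * (ε / (2 * C)) = ε / 2 := by field_simp
  linarith

/-- Consecutive interpolants at `y` differ by a multiple of `ρ^n`, and the geometric series
converges because `ρ < 1`. -/
theorem exists_localPoly_approx (hr : 0 < r) {F : (Fin d → ℝ) → ℝ}
    (hF : ContinuousOn F (unitBox d)) {N : ℕ} (hN : r ≤ 2 ^ N) {K ρ : ℝ} (hK : 0 ≤ K)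
    (hρ : 0 < ρ) (hρ1 : ρ < 1) (hD : DyadicBound r F N (fun n => K * ρ ^ n)) :
    ∃ C, 0 ≤ C ∧ ∀ n, N ≤ n → ∀ y ∈ unitBox d, |F y - localPoly r F n y y| ≤ C * ρ ^ n := by
  obtain ⟨C, hC, hb⟩ := SepPoly.bound d hr (r : ℝ)
  set D : ℝ := ((2 ^ r) ^ (3 * r)) ^ d with hDdef
  have hD0 : 0 ≤ D := by positivity
  have hC0 : 0 ≤ C := by linarith
  refine ⟨C * D * K / (1 - ρ), div_nonneg (by positivity) (by linarith), fun n hn y hy => ?_⟩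
  have hstep : ∀ l, dist (localPoly r F (n + l) y y) (localPoly r F (n + (l + 1)) y y)
      ≤ C * D * K * ρ ^ n * ρ ^ l := by
    intro l
    have hl : r ≤ 2 ^ (n + l) := hN.trans (Nat.pow_le_pow_right (by norm_num) (by omega))
    have h1 := hb _ ((sepPoly_localPoly hr F (n + l + 1) y).sub
      (sepPoly_localPoly hr F (n + l) y)) (n + l) _ _
      (nodeBound_localPoly_succ hr hD (by omega) hl (by positivity) hy) y fun j => by
        have := baseNode_near hr (n + l) hy j
        rw [abs_le]; constructor <;> linarith
    rw [dist_comm, Real.dist_eq]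
    refine h1.trans ?_
    have h2 : ρ ^ (n + l + 1) ≤ ρ ^ n * ρ ^ l := by
      rw [pow_succ, pow_add]
      exact mul_le_of_le_one_right (by positivity) hρ1.le
    calc C * (D * (K * ρ ^ (n + l + 1))) = C * D * K * ρ ^ (n + l + 1) := by ring
      _ ≤ C * D * K * (ρ ^ n * ρ ^ l) := by gcongr
      _ = _ := by ring
  have hlim : Tendsto (fun l => localPoly r F (n + l) y y) atTop (𝓝 (F y)) :=
    (tendsto_localPoly hr hF hy).comp (tendsto_atTop_mono (fun l => Nat.le_add_left l n) tendsto_id)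
  have := dist_le_of_le_geometric_of_tendsto₀ ρ _ hρ1 hstep hlim
  rw [dist_comm, Real.dist_eq, add_zero] at this
  refine this.trans (le_of_eq ?_)
  ring

/-- Each value `F (x + k h)` is first replaced by its own interpolant, and that one by the
interpolant of `x`, so that a single polynomial serves the whole difference. -/
theorem exists_seqDiff_approx (hr : 0 < r) {F : (Fin d → ℝ) → ℝ}
    (hF : ContinuousOn F (unitBox d)) {N : ℕ} (hN : r ≤ 2 ^ N) {K ρ : ℝ} (hK : 0 ≤ K)
    (hρ : 0 < ρ) (hρ1 : ρ < 1) (hD : DyadicBound r F N (fun n => K * ρ ^ n)) :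
    ∃ C, 0 ≤ C ∧ ∀ n, N ≤ n → ∀ x h : Fin d → ℝ, x ∈ unitBox d → x + (r : ℝ) • h ∈ unitBox d →
      (∀ j, |h j| ≤ width n) →
      |seqDiff r (fun k => F (x + (k : ℝ) • h))
        - seqDiff r (fun k => localPoly r F n x (x + (k : ℝ) • h))| ≤ C * ρ ^ n := by
  obtain ⟨C₁, hC₁, h₁⟩ := exists_localPoly_approx hr hF hN hK hρ hρ1 hD
  -- Radius `2 * r`: one `r` for the distance of `x` from its corner, one for the displacement `k
  -- h`.
  obtain ⟨C₂, hC₂, h₂⟩ := SepPoly.bound d hr (2 * r : ℝ)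
  set D : ℝ := ((2 ^ r) ^ (3 * r)) ^ d with hDdef
  have hD0 : 0 ≤ D := by positivity
  have hC0 : 0 ≤ C₂ := by linarith
  refine ⟨2 ^ r * (C₁ + C₂ * (D * K)), by positivity, fun n hn x h hx hxh hh => ?_⟩
  have hrn : r ≤ 2 ^ n := hN.trans (Nat.pow_le_pow_right (by norm_num) hn)
  rw [← seqDiff_sub, mul_assoc]
  refine abs_seqDiff_le fun k hk => ?_
  have hy := add_smul_mem_unitBox hx hxh hk
  have hk' : (k : ℝ) ≤ r := by exact_mod_cast hk
  have hkh : ∀ j, 2 ^ n * |(x + (k : ℝ) • h) j - x j| ≤ r := fun j => by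
    simp only [Pi.add_apply, Pi.smul_apply, smul_eq_mul, add_sub_cancel_left, abs_mul,
      Nat.abs_cast]
    calc (2 : ℝ) ^ n * (k * |h j|) ≤ 2 ^ n * (r * width n) := by gcongr; exact hh j
      _ = r := by linear_combination (r : ℝ) * two_pow_mul_width n
  have h3 := h₂ _ ((sepPoly_localPoly hr F n (x + (k : ℝ) • h)).sub (sepPoly_localPoly hr F n x))
    n _ _ (nodeBound_localPoly_sub hr hD hn hrn (by positivity) hx hy hkh) (x + (k : ℝ) • h)
    fun j => by
      have h5 := hkh j
      rw [← abs_of_pos (show (0 : ℝ) < 2 ^ n by positivity), ← abs_mul, abs_le, mul_sub] at h5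
      have := baseNode_near hr n hx j
      rw [abs_le]; constructor <;> linarith
  refine (abs_sub_le _ (localPoly r F n (x + (k : ℝ) • h) (x + (k : ℝ) • h)) _).trans ?_
  refine (add_le_add (h₁ n hn _ hy) h3).trans (le_of_eq (by ring))

/-- Marchaud type bound for differences in arbitrary directions. -/
theorem exists_seqDiff_bound (hr : 0 < r) {F : (Fin d → ℝ) → ℝ}
    (hF : ContinuousOn F (unitBox d)) {N : ℕ} (hN : r ≤ 2 ^ N) {K ρ : ℝ} (hK : 0 ≤ K)
    (hρ : 0 < ρ) (hρ1 : ρ < 1) (hD : DyadicBound r F N (fun n => K * ρ ^ n))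
    {S : ℝ} (hS : ∀ x ∈ unitBox d, |F x| ≤ S) :
    ∃ C, 0 ≤ C ∧ ∀ m, N ≤ m → ∀ x h : Fin d → ℝ, x ∈ unitBox d → x + (r : ℝ) • h ∈ unitBox d →
      (∀ j, |h j| ≤ width m) →
      |seqDiff r (fun k => F (x + (k : ℝ) • h))|
        ≤ C * (ρ ^ m + width m ^ r * ∑ n ∈ Finset.range (m + 1), (2 ^ r * ρ) ^ n) := by
  obtain ⟨C₁, hC₁, h₁⟩ := exists_seqDiff_approx hr hF hN hK hρ hρ1 hD
  obtain ⟨C₂, hC₂, h₂⟩ := SepPoly.seqDiff_bound d hr (r : ℝ)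
  set D : ℝ := ((2 ^ r) ^ (3 * r)) ^ d with hDdef
  have hD0 : 0 ≤ D := by positivity
  have hC0 : 0 ≤ C₂ := by linarith
  have hS0 : 0 ≤ S := (abs_nonneg _).trans (hS (fun _ => 0) fun _ => by simp)
  -- The first summand pays for the coarsest interpolant, bounded through `S`; the second for each
  -- passage from one level to the next.
  set E : ℝ := C₂ * ((2 ^ N) ^ r * S) + C₂ * (D * K) with hE
  have hE0 : 0 ≤ E := by positivity
  refine ⟨C₁ + E, by positivity, fun m hm x h hx hxh hh => ?_⟩
  have hw := width_pos m
  have hq : ∀ n : ℕ, (0 : ℝ) ≤ (2 ^ r * ρ) ^ n := fun n => by positivity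
  -- The step stays of size `width m` while the level `n` of the interpolant climbs from `N` to `m`.
  have key : ∀ n, N ≤ n → n ≤ m →
      |seqDiff r (fun k => localPoly r F n x (x + (k : ℝ) • h))|
        ≤ E * (width m ^ r * ∑ n ∈ Finset.range (n + 1), (2 ^ r * ρ) ^ n) := by
    intro n hn
    have hwid : ∀ n, n ≤ m → width m ≤ width n := fun n hn =>
      pow_le_pow_of_le_one (by norm_num) (by norm_num) hn
    have hnear : ∀ n j, |2 ^ n * x j - baseNode r n x j| ≤ r := fun n j => by
      have := baseNode_near hr n hx j
      rw [abs_le]; constructor <;> linarith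
    induction n, hn using Nat.le_induction with
    | base =>
      intro hNm
      have h3 := h₂ _ (sepPoly_localPoly hr F N x) N (baseNode r N x) S (fun a ha => by
        rw [localPoly_node F N x a ha]
        refine hS _ (mesh_mem_unitBox fun j => ?_)
        have := baseNode_mem hN hx j
        have := ha j
        constructor <;> omega) h (width m) hw.le (hwid N hNm) hh x (hnear N)
      refine h3.trans ?_
      -- The coarsest level is absorbed by the term of index `0`, equal to `1`.
      have h4 : (1 : ℝ) ≤ ∑ n ∈ Finset.range (N + 1), (2 ^ r * ρ) ^ n := by
        rw [Finset.sum_range_succ']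
        simpa using Finset.sum_nonneg fun i _ => hq (i + 1)
      calc C₂ * (2 ^ N * width m) ^ r * S = C₂ * ((2 ^ N) ^ r * S) * (width m ^ r * 1) := by
            rw [mul_pow]; ring
        _ ≤ E * (width m ^ r * ∑ n ∈ Finset.range (N + 1), (2 ^ r * ρ) ^ n) := by
            gcongr
            rw [hE]
            linarith [show 0 ≤ C₂ * (D * K) by positivity]
    | succ n hn ih =>
      intro hnm
      have hrn : r ≤ 2 ^ n := hN.trans (Nat.pow_le_pow_right (by norm_num) hn)
      have h3 := h₂ _ ((sepPoly_localPoly hr F (n + 1) x).sub (sepPoly_localPoly hr F n x)) n _ _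
        (nodeBound_localPoly_succ hr hD (by omega) hrn (by positivity) hx) h (width m) hw.le
        (hwid n (by omega)) hh x (hnear n)
      rw [seqDiff_sub] at h3
      have h4 := ih (by omega)
      have h5 : C₂ * (2 ^ n * width m) ^ r * (D * (K * ρ ^ (n + 1)))
          ≤ E * (width m ^ r * (2 ^ r * ρ) ^ (n + 1)) := by
        calc C₂ * (2 ^ n * width m) ^ r * (D * (K * ρ ^ (n + 1)))
            = C₂ * (D * K) * (width m ^ r * ((2 ^ n) ^ r * ρ ^ (n + 1))) := by
              rw [mul_pow]; ring
          _ ≤ E * (width m ^ r * (2 ^ r * ρ) ^ (n + 1)) := by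
              have h6 : ((2 : ℝ) ^ n) ^ r ≤ (2 ^ r) ^ (n + 1) := by
                rw [← pow_mul, ← pow_mul, Nat.mul_comm]
                exact pow_le_pow_right₀ (by norm_num) (Nat.mul_le_mul_left r (by omega))
              have h7 : C₂ * (D * K) ≤ E := by
                rw [hE]
                linarith [show 0 ≤ C₂ * ((2 ^ N) ^ r * S) by positivity]
              rw [mul_pow]
              gcongr
      rw [Finset.sum_range_succ, mul_add, mul_add]
      have := abs_sub_abs_le_abs_sub
        (seqDiff r (fun k => localPoly r F (n + 1) x (x + (k : ℝ) • h)))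
        (seqDiff r (fun k => localPoly r F n x (x + (k : ℝ) • h)))
      linarith
  have h3 := h₁ m hm x h hx hxh hh
  have h4 := key m hm le_rfl
  have h5 := abs_sub_abs_le_abs_sub (seqDiff r (fun k => F (x + (k : ℝ) • h)))
    (seqDiff r (fun k => localPoly r F m x (x + (k : ℝ) • h)))
  have h6 : 0 ≤ width m ^ r * ∑ n ∈ Finset.range (m + 1), (2 ^ r * ρ) ^ n :=
    mul_nonneg (by positivity) (Finset.sum_nonneg fun n _ => hq n)
  have h7 : 0 ≤ E * ρ ^ m := by positivity
  have h8 := mul_nonneg hC₁ h6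
  rw [mul_add, add_mul, add_mul]
  linarith

/-! ### From dyadic scales to power bounds at all scales. -/

theorem exists_width_near {τ : ℝ} {N : ℕ} (hτ : 0 < τ) (hτN : τ ≤ width N) :
    ∃ m, N ≤ m ∧ τ ≤ width m ∧ width m < 2 * τ := by
  obtain ⟨m, hm1, hm2⟩ := exists_nat_pow_near_of_lt_one hτ (hτN.trans (width_le_one N))
    (by norm_num : (0 : ℝ) < 2⁻¹) (by norm_num)
  refine ⟨m, ?_, hm2, ?_⟩
  · have := (pow_lt_pow_iff_right_of_lt_one₀ (by norm_num : (0 : ℝ) < 2⁻¹) (by norm_num)).1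
      (hm1.trans_le hτN)
    omega
  · rw [pow_succ] at hm1
    rw [width]
    linarith

theorem width_rpow (α : ℝ) (m : ℕ) : width m ^ α = ((2 : ℝ) ^ (-α)) ^ m := by
  rw [width, ← Real.rpow_natCast, ← Real.rpow_natCast, Real.rpow_neg (by norm_num),
    ← Real.inv_rpow (by norm_num), ← Real.rpow_mul (by norm_num), ← Real.rpow_mul (by norm_num),
    mul_comm]

theorem two_rpow_neg_mul (α : ℝ) (n : ℕ) : (2 : ℝ) ^ (-((n : ℝ) * α)) = ((2 : ℝ) ^ (-α)) ^ n := by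
  rw [← Real.rpow_natCast, ← Real.rpow_mul (by norm_num)]
  congr 1
  ring

/-- A dyadic power bound at small scales together with a global bound gives a power bound. -/
theorem exists_rpow_bound {α : ℝ} (hα : 0 < α) (N : ℕ) {B C : ℝ} (hB : 0 ≤ B) (hC : 0 ≤ C) :
    ∃ M, 0 ≤ M ∧ ∀ v τ : ℝ, 0 < τ → v ≤ B →
      (∀ m, N ≤ m → τ ≤ width m → v ≤ C * ((2 : ℝ) ^ (-α)) ^ m) → v ≤ M * τ ^ α := by
  have hw := width_pos N
  refine ⟨B / width N ^ α + C * 2 ^ α, by positivity, fun v τ hτ hv h => ?_⟩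
  have hτα : 0 < τ ^ α := Real.rpow_pos_of_pos hτ α
  rw [add_mul]
  rcases le_or_gt τ (width N) with h1 | h1
  · obtain ⟨m, hm, h2, h3⟩ := exists_width_near hτ h1
    have h4 := h m hm h2
    rw [← width_rpow] at h4
    have h5 : width m ^ α ≤ 2 ^ α * τ ^ α := by
      rw [← Real.mul_rpow (by norm_num) hτ.le]
      exact Real.rpow_le_rpow (width_pos m).le h3.le hα.le
    calc v ≤ C * (2 ^ α * τ ^ α) := h4.trans (mul_le_mul_of_nonneg_left h5 hC)
      _ = C * 2 ^ α * τ ^ α := by ring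
      _ ≤ _ := le_add_of_nonneg_left (by positivity)
  · have h2 : width N ^ α ≤ τ ^ α := Real.rpow_le_rpow hw.le h1.le hα.le
    calc v ≤ B := hv
      _ = B / width N ^ α * width N ^ α := by field_simp
      _ ≤ B / width N ^ α * τ ^ α := by gcongr
      _ ≤ _ := le_add_of_nonneg_right (by positivity)

theorem two_rpow_neg_lt_one {α : ℝ} (hα : 0 < α) : (2 : ℝ) ^ (-α) < 1 :=
  Real.rpow_lt_one_of_one_lt_of_neg (by norm_num) (by linarith)

theorem isCompact_unitBox (d : ℕ) : IsCompact (unitBox d) := by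
  have : unitBox d = Set.univ.pi fun _ => Set.Icc (0 : ℝ) 1 := by
    ext x; simp only [unitBox, Set.mem_pi, Set.mem_univ, true_imp_iff]; rfl
  rw [this]
  exact isCompact_univ_pi fun _ => isCompact_Icc

theorem exists_bound_on_unitBox {F : (Fin d → ℝ) → ℝ} (hF : ContinuousOn F (unitBox d)) :
    ∃ S, 0 ≤ S ∧ ∀ x ∈ unitBox d, |F x| ≤ S := by
  obtain ⟨S, hS⟩ := (isCompact_unitBox d).exists_bound_of_continuousOn hF
  exact ⟨max S 0, le_max_right _ _, fun x hx => (hS x hx).trans (le_max_left _ _)⟩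

theorem abs_seqDiff_le_of_mem {F : (Fin d → ℝ) → ℝ} {S : ℝ}
    (hS : ∀ x ∈ unitBox d, |F x| ≤ S) {x h : Fin d → ℝ} (hx : x ∈ unitBox d)
    (hxh : x + (r : ℝ) • h ∈ unitBox d) :
    |seqDiff r (fun k => F (x + (k : ℝ) • h))| ≤ 2 ^ r * S :=
  abs_seqDiff_le fun _ hk => hS _ (add_smul_mem_unitBox hx hxh hk)

theorem DyadicBound.mono {F : (Fin d → ℝ) → ℝ} {N N' : ℕ} {ε : ℕ → ℝ}
    (h : DyadicBound r F N ε) (hN : N ≤ N') : DyadicBound r F N' ε :=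
  fun n hn => h n (hN.trans hn)

theorem exists_le_two_pow (r N : ℕ) : ∃ N', N ≤ N' ∧ r ≤ 2 ^ N' :=
  ⟨N + r, by omega, Nat.lt_two_pow_self.le.trans (Nat.pow_le_pow_right (by norm_num) (by omega))⟩

/-- Along an axis the `r`-th difference of the local polynomial is zero, so only the approximation
error remains. No sum over levels occurs, hence no loss at `α = r`. -/
theorem exists_directional_bound (hr : 0 < r) {F : (Fin d → ℝ) → ℝ}
    (hF : ContinuousOn F (unitBox d)) {N : ℕ} {K α : ℝ} (hK : 0 ≤ K) (hα : 0 < α)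
    (hD : DyadicBound r F N (fun n => K * ((2 : ℝ) ^ (-α)) ^ n)) :
    ∃ M, 0 ≤ M ∧ ∀ (i : Fin d) (t : ℝ) (x : Fin d → ℝ), 0 < t → x ∈ unitBox d →
      x + (r : ℝ) • Pi.single i t ∈ unitBox d →
      |seqDiff r (fun k => F (x + (k : ℝ) • Pi.single i t))| ≤ M * t ^ α := by
  obtain ⟨N', hNN', hN'⟩ := exists_le_two_pow r N
  obtain ⟨S, hS0, hS⟩ := exists_bound_on_unitBox hF
  obtain ⟨C, hC, h⟩ := exists_seqDiff_approx hr hF hN' hK (by positivity)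
    (two_rpow_neg_lt_one hα) (hD.mono hNN')
  obtain ⟨M, hM, hM'⟩ := exists_rpow_bound hα N' (B := 2 ^ r * S) (by positivity) hC
  refine ⟨M, hM, fun i t x ht hx hxt => hM' _ t ht (abs_seqDiff_le_of_mem hS hx hxt)
    fun m hm htm => ?_⟩
  have := h m hm x (Pi.single i t) hx hxt fun j => by
    by_cases hj : j = i
    · subst hj; simpa [abs_of_pos ht] using htm
    · simpa [hj] using (width_pos m).le
  rwa [(sepPoly_localPoly hr F m x).seqDiff_single, sub_zero] at this

/-- For `r = 1` the origin is the only node, and `P - P 0` vanishes there. -/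
theorem SepPoly.eq_of_one {P : (Fin d → ℝ) → ℝ} (hP : SepPoly 1 P) (y : Fin d → ℝ) :
    P y = P 0 := by
  obtain ⟨C, -, h⟩ := SepPoly.bound_unit (r := 1) d one_pos ‖y‖
  have := h _ (hP.sub (sepPoly_const one_pos (P 0))) 0 (fun a ha => by
    have : (fun j => (a j : ℝ)) = 0 := by
      ext j; simpa using Nat.lt_one_iff.1 (ha j)
    rw [this]; simp) y fun j => norm_le_pi_norm y j
  rw [mul_zero] at this
  linarith [abs_nonpos_iff.1 this]

theorem geom_sum_le_pow {q : ℝ} (hq : 1 < q) (m : ℕ) :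
    ∑ n ∈ Finset.range (m + 1), q ^ n ≤ q / (q - 1) * q ^ m := by
  rw [geom_sum_eq hq.ne', div_mul_eq_mul_div, pow_succ']
  gcongr
  linarith

/-- If `α < r`, the ratio `2^r ρ = 2^(r-α)` exceeds `1`, so the sum in the Marchaud bound is
comparable to its last term and `width m ^ r * (2^r ρ)^m = ρ^m`. If `r = 1`, the local polynomials
are constant and `exists_seqDiff_approx` alone suffices. -/
theorem exists_isotropic_bound (hr : 0 < r) {F : (Fin d → ℝ) → ℝ}
    (hF : ContinuousOn F (unitBox d)) {N : ℕ} {K α : ℝ} (hK : 0 ≤ K) (hα : 0 < α)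
    (hαr : α < r ∨ r = 1)
    (hD : DyadicBound r F N (fun n => K * ((2 : ℝ) ^ (-α)) ^ n)) :
    ∃ M, 0 ≤ M ∧ ∀ (x h : Fin d → ℝ) (τ : ℝ), 0 < τ → x ∈ unitBox d →
      x + (r : ℝ) • h ∈ unitBox d → (∀ j, |h j| ≤ τ) →
      |seqDiff r (fun k => F (x + (k : ℝ) • h))| ≤ M * τ ^ α := by
  obtain ⟨N', hNN', hN'⟩ := exists_le_two_pow r N
  obtain ⟨S, hS0, hS⟩ := exists_bound_on_unitBox hF
  obtain ⟨C, hC, h⟩ : ∃ C, 0 ≤ C ∧ ∀ m, N' ≤ m → ∀ x h : Fin d → ℝ, x ∈ unitBox d →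
      x + (r : ℝ) • h ∈ unitBox d → (∀ j, |h j| ≤ width m) →
      |seqDiff r (fun k => F (x + (k : ℝ) • h))| ≤ C * ((2 : ℝ) ^ (-α)) ^ m := by
    rcases hαr with hαr | rfl
    · obtain ⟨C, hC, h⟩ := exists_seqDiff_bound hr hF hN' hK (by positivity)
        (two_rpow_neg_lt_one hα) (hD.mono hNN') hS
      set ρ : ℝ := (2 : ℝ) ^ (-α) with hρ
      have hq : 1 < 2 ^ r * ρ := by
        rw [hρ, ← Real.rpow_natCast, ← Real.rpow_add (by norm_num)]
        exact Real.one_lt_rpow (by norm_num) (by linarith)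
      have hq0 : 0 < 2 ^ r * ρ - 1 := by linarith
      refine ⟨C * (1 + 2 ^ r * ρ / (2 ^ r * ρ - 1)), by positivity,
        fun m hm x h' hx hxh hh => (h m hm x h' hx hxh hh).trans ?_⟩
      rw [mul_assoc, add_mul, one_mul]
      refine mul_le_mul_of_nonneg_left (add_le_add le_rfl ?_) hC
      have hw := width_pos m
      refine (mul_le_mul_of_nonneg_left (geom_sum_le_pow hq m) (by positivity)).trans (le_of_eq ?_)
      have e : width m ^ r * (2 ^ r * ρ) ^ m = ρ ^ m := by
        rw [mul_pow, ← mul_assoc, ← pow_mul, mul_comm r m, pow_mul, ← mul_pow, mul_comm (width m),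
          two_pow_mul_width, one_pow, one_mul]
      rw [mul_left_comm, e]
    · obtain ⟨C, hC, h⟩ := exists_seqDiff_approx hr hF hN' hK (by positivity)
        (two_rpow_neg_lt_one hα) (hD.mono hNN')
      refine ⟨C, hC, fun m hm x h' hx hxh hh => ?_⟩
      have := h m hm x h' hx hxh hh
      have hc := (sepPoly_localPoly hr F m x).eq_of_one
      have e : seqDiff 1 (fun k => localPoly 1 F m x (x + (k : ℝ) • h')) = 0 := by
        simp [seqDiff, Finset.sum_range_succ, hc (x + h'), hc x]
      rwa [e, sub_zero] at this
  obtain ⟨M, hM, hM'⟩ := exists_rpow_bound hα N' (B := 2 ^ r * S) (by positivity) hC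
  exact ⟨M, hM, fun x h' τ hτ hx hxh hh => hM' _ τ hτ (abs_seqDiff_le_of_mem hS hx hxh)
    fun m hm hτm => h m hm x h' hx hxh fun j => (hh j).trans hτm⟩

/-! ### Passage to Euclidean space -/

/-- A function on Euclidean space as a function of its coordinates. -/
def inCoords (f : Space d → ℝ) : (Fin d → ℝ) → ℝ := fun y => f (WithLp.toLp 2 y)

theorem continuousOn_inCoords {f : Space d → ℝ} (hf : ContinuousOn f (cube d)) :
    ContinuousOn (inCoords f) (unitBox d) :=
  hf.comp (PiLp.continuous_toLp 2 _).continuousOn fun _ hx => hx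

theorem diff_eq_seqDiff (f : Space d → ℝ) (h x : Space d) :
    diff r h f x = seqDiff r (fun k => inCoords f (x.ofLp + (k : ℝ) • h.ofLp)) := rfl

theorem ofLp_smul_unitVec (t : ℝ) (i : Fin d) :
    (t • unitVec i : Space d).ofLp = Pi.single i t := by
  ext j
  by_cases hj : j = i
  · subst hj; simp [unitVec]
  · simp [unitVec, hj]

theorem norm_unitVec (i : Fin d) : ‖unitVec i‖ = 1 := by simp [unitVec]

theorem abs_apply_le_norm (x : Space d) (j : Fin d) : |x j| ≤ ‖x‖ := by
  simpa using PiLp.norm_apply_le x j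

theorem add_mul_smul_mem_iff (x : Space d) (t : ℝ) (v : Space d) :
    x + ((r : ℝ) * t) • v ∈ cube d ↔ x.ofLp + (r : ℝ) • (t • v).ofLp ∈ unitBox d := by
  rw [mul_smul]; rfl

theorem meshPoint_mem_cube {n : ℕ} {k : Fin d → ℤ} :
    meshPoint n k ∈ cube d ↔ ∀ j, 0 ≤ k j ∧ k j ≤ 2 ^ n := by
  refine ⟨fun h j => ?_, fun h => mesh_mem_unitBox h⟩
  have h1 := (h j).1
  have h2 := (h j).2
  simp only [meshPoint] at h1 h2
  constructor
  · exact_mod_cast nonneg_of_mul_nonneg_right h1 (width_pos n)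
  · rw [← two_pow_mul_width n, mul_comm] at h2
    exact_mod_cast le_of_mul_le_mul_right h2 (width_pos n)

theorem meshPoint_add_eq (n : ℕ) (k : Fin d → ℤ) (i : Fin d) :
    meshPoint n k + ((r : ℝ) * width n) • unitVec i
      = meshPoint n (Function.update k i (k i + r)) := by
  ext j
  by_cases hj : j = i
  · subst hj; simp [meshPoint, unitVec]; ring
  · simp [meshPoint, unitVec, hj]

theorem meshPoint_add_mem_cube {n : ℕ} {k : Fin d → ℤ} {i : Fin d}
    (hk : meshPoint n k ∈ cube d) :
    meshPoint n k + ((r : ℝ) * width n) • unitVec i ∈ cube d ↔ k i + r ≤ 2 ^ n := by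
  rw [meshPoint_add_eq, meshPoint_mem_cube]
  rw [meshPoint_mem_cube] at hk
  refine ⟨fun h => by simpa using (h i).2, fun h j => ?_⟩
  by_cases hj : j = i
  · subst hj
    have := hk j
    simp only [Function.update_self]
    constructor <;> omega
  · simpa [hj] using hk j

theorem diff_width_eq (f : Space d → ℝ) (n : ℕ) (k : Fin d → ℤ) (i : Fin d) :
    diff r (width n • unitVec i) f (meshPoint n k)
      = seqDiff r (fun l => inCoords f (mesh n k + (l : ℝ) • Pi.single i (width n))) := by
  rw [diff_eq_seqDiff, ofLp_smul_unitVec]; rfl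

theorem exists_dyadicBound_of_isBigO {f : Space d → ℝ} (hf : ContinuousOn f (cube d)) {α : ℝ}
    (h : (fun n : ℕ => discreteModulus r f n) =O[atTop] (fun n : ℕ => (2 : ℝ) ^ (-((n : ℝ) * α)))) :
    ∃ K, 0 ≤ K ∧ ∃ N, DyadicBound r (inCoords f) N (fun n => K * ((2 : ℝ) ^ (-α)) ^ n) := by
  obtain ⟨K, hK, hb⟩ := h.exists_nonneg
  obtain ⟨N, hN⟩ := eventually_atTop.1 hb.bound
  obtain ⟨S, hS0, hS⟩ := exists_bound_on_unitBox (continuousOn_inCoords hf)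
  refine ⟨K, hK, N, fun n hn i k hk hki => ?_⟩
  have h1 := hN n hn
  rw [two_rpow_neg_mul, Real.norm_eq_abs, Real.norm_eq_abs,
    abs_of_pos (show 0 < ((2 : ℝ) ^ (-α)) ^ n by positivity)] at h1
  refine le_trans (?_ : _ ≤ discreteModulus r f n) ((le_abs_self _).trans h1)
  have hk' := meshPoint_mem_cube.2 hk
  rw [← diff_width_eq]
  -- A real `sSup` dominates its elements only if the set is bounded; the bound of `f` on the
  -- compact cube provides this.
  refine le_csSup ⟨2 ^ r * S, ?_⟩ ⟨i, k, hk', (meshPoint_add_mem_cube hk').2 hki, rfl⟩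
  rintro v ⟨i, k, h2, h3, rfl⟩
  rw [diff_eq_seqDiff]
  exact abs_seqDiff_le_of_mem hS h2 ((add_mul_smul_mem_iff _ _ _).1 h3)

theorem modulus_le_of_forall {f : Space d → ℝ} {t A : ℝ} (hA : 0 ≤ A)
    (h : ∀ h x : Fin d → ℝ, (∀ j, |h j| ≤ t) → x ∈ unitBox d → x + (r : ℝ) • h ∈ unitBox d →
      |seqDiff r (fun k => inCoords f (x + (k : ℝ) • h))| ≤ A) : modulus r f t ≤ A := by
  refine Real.sSup_le ?_ hA
  rintro v ⟨v, x, hv, hx, hxv, rfl⟩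
  exact h _ _ (fun j => (abs_apply_le_norm v j).trans hv) hx hxv

theorem modulus_le_rpow (hr : 0 < r) {f : Space d → ℝ} (hf : ContinuousOn f (cube d)) {α : ℝ}
    (hα : 0 < α) (hαr : α < r ∨ r = 1)
    (h : (fun n : ℕ => discreteModulus r f n) =O[atTop] (fun n : ℕ => (2 : ℝ) ^ (-((n : ℝ) * α)))) :
    ∃ M : ℝ, ∀ t : ℝ, 0 < t → modulus r f t ≤ M * t ^ α := by
  obtain ⟨K, hK, N, hD⟩ := exists_dyadicBound_of_isBigO hf h
  obtain ⟨M, hM, hb⟩ := exists_isotropic_bound hr (continuousOn_inCoords hf) hK hα hαr hD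
  exact ⟨M, fun t ht => modulus_le_of_forall (by positivity) fun h x hh hx hxh =>
    hb x h t ht hx hxh hh⟩

theorem exists_unit_direction_bound_iff (hr : 0 < r) {f : Space d → ℝ}
    (hf : ContinuousOn f (cube d)) {α : ℝ} (hα : 0 < α) (hαr : α < r ∨ r = 1) :
    (∃ M : ℝ, ∀ n : ℕ, 1 ≤ n → ∀ (i : Fin d) (k : Fin d → ℤ),
        0 ≤ k i → k i ≤ (2 : ℤ) ^ n - (r : ℤ) → (∀ j, j ≠ i → 0 ≤ k j ∧ k j ≤ (2 : ℤ) ^ n) →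
        |diff r (width n • unitVec i) f (meshPoint n k)| ≤ M * (2 : ℝ) ^ (-((n : ℝ) * α))) ↔
      ∃ M₁ : ℝ, ∀ (ξ e : Space d) (h : ℝ), 0 < h → ‖e‖ = 1 → ξ ∈ cube d →
        ξ + ((r : ℝ) * h) • e ∈ cube d → |diff r (h • e) f ξ| ≤ M₁ * h ^ α := by
  constructor
  · rintro ⟨M, hM⟩
    -- `N := 1` matches the condition `1 ≤ n`; `|M|` replaces `M`, whose sign is not known.
    obtain ⟨M₁, -, hb⟩ := exists_isotropic_bound (N := 1) hr (continuousOn_inCoords hf)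
      (abs_nonneg M) hα hαr (fun n hn i k hk hki => by
        rw [← diff_width_eq]
        simp only [← two_rpow_neg_mul]
        exact (hM n hn i k (hk i).1 (by linarith) fun j _ => hk j).trans
          (mul_le_mul_of_nonneg_right (le_abs_self M) (by positivity)))
    refine ⟨M₁, fun ξ e h hh he hξ hξe => hb _ _ h hh hξ ((add_mul_smul_mem_iff _ _ _).1 hξe)
      fun j => (abs_apply_le_norm (h • e) j).trans ?_⟩
    rw [norm_smul, he, mul_one, Real.norm_eq_abs, abs_of_pos hh]
  · rintro ⟨M, hM⟩
    refine ⟨M, fun n _ i k h0 h1 hk => ?_⟩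
    have hmem : meshPoint n k ∈ cube d := meshPoint_mem_cube.2 fun j => by
      by_cases hj : j = i
      · subst hj; constructor <;> omega
      · exact hk j hj
    rw [two_rpow_neg_mul, ← width_rpow]
    exact hM _ _ _ (width_pos n) (norm_unitVec i) hmem
      ((meshPoint_add_mem_cube hmem).2 (by linarith))

/-! ### The logarithmic example: axis differences. -/

/-- The sum is the Taylor polynomial of `-log (1 + v)`. For `v ≤ 1/2` this is the remainder
estimate; for larger `v` the left side is bounded by compactness and `v^(q+1)` is bounded below. -/
theorem exists_log_taylor (q : ℕ) (R : ℝ) :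
    ∃ D, 0 ≤ D ∧ ∀ v, 0 ≤ v → v ≤ R →
      |∑ i ∈ Finset.range q, (-v) ^ (i + 1) / (i + 1) + Real.log (1 + v)| ≤ D * v ^ (q + 1) := by
  have hc : ContinuousOn (fun v : ℝ => ∑ i ∈ Finset.range q, (-v) ^ (i + 1) / ((i : ℝ) + 1)
      + Real.log (1 + v)) (Set.Icc 0 R) := by
    refine ContinuousOn.add (by fun_prop) (ContinuousOn.log (by fun_prop) fun v hv => ?_)
    have := hv.1
    positivity
  obtain ⟨B, hB⟩ := isCompact_Icc.exists_bound_of_continuousOn hc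
  refine ⟨2 + 2 ^ (q + 1) * |B|, by positivity, fun v hv hvR => ?_⟩
  rw [add_mul]
  rcases le_or_gt v (1 / 2) with h | h
  · have h1 := Real.abs_log_sub_add_sum_range_le (x := -v)
      (by rw [abs_neg, abs_of_nonneg hv]; linarith) q
    rw [abs_neg, abs_of_nonneg hv, sub_neg_eq_add] at h1
    refine h1.trans ?_
    have h2 : v ^ (q + 1) / (1 - v) ≤ 2 * v ^ (q + 1) := by
      rw [div_le_iff₀ (by linarith)]
      nlinarith [pow_nonneg hv (q + 1)]
    exact h2.trans (le_add_of_nonneg_right (by positivity))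
  · have h1 := (hB v ⟨hv, hvR⟩).trans (le_abs_self B)
    rw [Real.norm_eq_abs] at h1
    refine h1.trans ?_
    have h2 : (1 : ℝ) ≤ 2 ^ (q + 1) * v ^ (q + 1) := by
      rw [← mul_pow]; exact one_le_pow₀ (by linarith)
    calc |B| ≤ |B| * (2 ^ (q + 1) * v ^ (q + 1)) := le_mul_of_one_le_right (abs_nonneg _) h2
      _ = 2 ^ (q + 1) * |B| * v ^ (q + 1) := by ring
      _ ≤ _ := le_add_of_nonneg_left (by positivity)

/-- Subtract the Taylor polynomial of degree `r - 1 - p` from the logarithm. Multiplied by `l^p` it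
has degree `< r` in `l`, so the difference annihilates it, and the remainder has order `u^(r-p)`. -/
theorem exists_seqDiff_pow_mul_log_bound {p : ℕ} (hp : p < r) :
    ∃ C, 0 ≤ C ∧ ∀ u : ℝ, 0 ≤ u → u ≤ 1 →
      |seqDiff r (fun l => (l : ℝ) ^ p * Real.log (1 + l * u))| ≤ C * u ^ (r - p) := by
  obtain ⟨q, rfl⟩ : ∃ q, r = p + q + 1 := ⟨r - p - 1, by omega⟩
  set r := p + q + 1 with hr
  obtain ⟨D, hD, hD'⟩ := exists_log_taylor q r
  refine ⟨2 ^ r * (r ^ p * (D * r ^ (q + 1))), by positivity, fun u hu hu1 => ?_⟩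
  rw [show r - p = q + 1 by omega]
  set T : Polynomial ℝ := Polynomial.X ^ p * ∑ i ∈ Finset.range q,
    Polynomial.C ((i + 1 : ℝ)⁻¹) * (Polynomial.C (-u) * Polynomial.X) ^ (i + 1) with hT
  have hTd : T.natDegree < r := by
    have h1 : (∑ i ∈ Finset.range q, Polynomial.C ((i + 1 : ℝ)⁻¹) *
        (Polynomial.C (-u) * Polynomial.X) ^ (i + 1)).natDegree ≤ q := by
      refine Polynomial.natDegree_sum_le_of_forall_le _ _ fun i hi => ?_
      refine (Polynomial.natDegree_C_mul_le _ _).trans (Polynomial.natDegree_pow_le.trans ?_)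
      have h2 : (Polynomial.C (-u) * Polynomial.X).natDegree ≤ 1 := by compute_degree
      have := Finset.mem_range.1 hi
      nlinarith
    have h2 := Polynomial.natDegree_mul_le (p := (Polynomial.X : Polynomial ℝ) ^ p)
      (q := ∑ i ∈ Finset.range q, Polynomial.C ((i + 1 : ℝ)⁻¹) *
        (Polynomial.C (-u) * Polynomial.X) ^ (i + 1))
    rw [Polynomial.natDegree_X_pow, ← hT] at h2
    omega
  have h0 := seqDiff_eval hTd 0 1
  have e : seqDiff r (fun l => (l : ℝ) ^ p * Real.log (1 + l * u))
      = seqDiff r (fun l => (l : ℝ) ^ p * (∑ i ∈ Finset.range q, (-(l * u)) ^ (i + 1) / ((i : ℝ) + 1)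
        + Real.log (1 + l * u))) := by
    rw [← sub_zero (seqDiff r (fun l => (l : ℝ) ^ p * (∑ i ∈ Finset.range q,
      (-(l * u)) ^ (i + 1) / ((i : ℝ) + 1) + Real.log (1 + l * u)))), ← h0, ← seqDiff_sub]
    congr 1
    ext l
    have : T.eval (0 + (l : ℝ) * 1)
        = (l : ℝ) ^ p * ∑ i ∈ Finset.range q, (-(l * u)) ^ (i + 1) / ((i : ℝ) + 1) := by
      simp only [hT, Polynomial.eval_mul, Polynomial.eval_pow, Polynomial.eval_X,
        Polynomial.eval_finsetSum, Polynomial.eval_C, zero_add, mul_one]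
      congr 1
      refine Finset.sum_congr rfl fun i _ => ?_
      rw [div_eq_inv_mul]
      congr 2
      ring
    rw [this]
    ring
  rw [e, mul_assoc]
  refine abs_seqDiff_le fun l hl => ?_
  have hl' : (l : ℝ) ≤ r := by exact_mod_cast hl
  have h1 := hD' (l * u) (by positivity) ((mul_le_of_le_one_right (by positivity) hu1).trans hl')
  rw [abs_mul, abs_pow, Nat.abs_cast, mul_assoc]
  have h2 : D * (l * u) ^ (q + 1) ≤ D * r ^ (q + 1) * u ^ (q + 1) := by
    rw [mul_pow, ← mul_assoc]; gcongr
  exact mul_le_mul (by gcongr) (h1.trans h2) (abs_nonneg _) (by positivity)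

theorem log_scaled_add {w s l : ℝ} (hw : 0 < w) (hs : 0 < s) (hl : 0 ≤ l) :
    Real.log (w * (s + l)) = Real.log (w * s) + Real.log (1 + l * s⁻¹) := by
  rw [← Real.log_mul (by positivity) (by positivity)]
  congr 1
  field_simp

/-- With `s = a + b`, split `log (w (s + l)) = log (w s) + log (1 + l / s)`. The unbounded part
multiplies a polynomial of degree `r - 1` in `l` and disappears. After binomial expansion the term
of index `p` carries `a^(r-1-p) b s^(-(r-p)) ≤ 1`. -/
theorem exists_seqDiff_log_fst_bound (hr : 1 < r) :
    ∃ C, 0 ≤ C ∧ ∀ w a b : ℝ, 0 < w → 0 ≤ a → 0 ≤ b → 1 ≤ a + b →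
      |seqDiff r (fun l => (w * (a + l)) ^ (r - 1) * (w * b) * Real.log (w * (a + b + l)))|
        ≤ C * w ^ r := by
  -- The dummy constant `0` for `p ≥ r` lets `choose` produce a constant for every `p`.
  have : ∀ p, ∃ C, 0 ≤ C ∧ (p < r → ∀ u : ℝ, 0 ≤ u → u ≤ 1 →
      |seqDiff r (fun l => (l : ℝ) ^ p * Real.log (1 + l * u))| ≤ C * u ^ (r - p)) := fun p => by
    by_cases hp : p < r
    · obtain ⟨C, hC, h⟩ := exists_seqDiff_pow_mul_log_bound hp
      exact ⟨C, hC, fun _ => h⟩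
    · exact ⟨0, le_rfl, fun h => absurd h hp⟩
  choose C hC h using this
  refine ⟨∑ p ∈ Finset.range r, (r - 1).choose p * C p,
    Finset.sum_nonneg fun p _ => mul_nonneg (by positivity) (hC p), fun w a b hw ha hb hab => ?_⟩
  set s := a + b with hs
  have hs0 : 0 < s := by linarith
  have hpoly : seqDiff r (fun l => (w * (a + l)) ^ (r - 1) * (w * b) * Real.log (w * s)) = 0 := by
    have hd : (Polynomial.X ^ (r - 1) * Polynomial.C (w * b * Real.log (w * s))).natDegree < r := by
      refine lt_of_le_of_lt (Polynomial.natDegree_mul_C_le _ _) ?_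
      rw [Polynomial.natDegree_X_pow]; omega
    rw [← seqDiff_eval hd (w * a) w]
    congr 1
    ext l
    simp only [Polynomial.eval_mul, Polynomial.eval_pow, Polynomial.eval_X, Polynomial.eval_C]
    ring
  have e : seqDiff r (fun l => (w * (a + l)) ^ (r - 1) * (w * b) * Real.log (w * (s + l)))
      = ∑ p ∈ Finset.range r, (w ^ r * ((r - 1).choose p * (a ^ (r - 1 - p) * b))) *
        seqDiff r (fun l => (l : ℝ) ^ p * Real.log (1 + l * s⁻¹)) := by
    rw [← sub_zero (seqDiff r _), ← hpoly, ← seqDiff_sub]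
    simp only [← seqDiff_const_mul]
    rw [← seqDiff_finsetSum]
    congr 1
    ext l
    rw [log_scaled_add hw hs0 (by positivity), mul_add, add_sub_cancel_left, mul_pow, add_comm a,
      add_pow, show r - 1 + 1 = r by omega]
    simp only [Finset.sum_mul, Finset.mul_sum]
    refine Finset.sum_congr rfl fun p _ => ?_
    have : w ^ r = w ^ (r - 1) * w := by rw [← pow_succ, show r - 1 + 1 = r by omega]
    rw [this]
    ring
  rw [e, Finset.sum_mul]
  refine (Finset.abs_sum_le_sum_abs _ _).trans (Finset.sum_le_sum fun p hp => ?_)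
  have hp' := Finset.mem_range.1 hp
  have h1 := h p hp' s⁻¹ (by positivity) (inv_le_one_of_one_le₀ hab)
  have h2 : a ^ (r - 1 - p) * b * s⁻¹ ^ (r - p) ≤ 1 := by
    have : a ^ (r - 1 - p) * b ≤ s ^ (r - p) := by
      rw [show r - p = r - 1 - p + 1 by omega, pow_succ]
      have : a ≤ s := by linarith
      have : b ≤ s := by linarith
      gcongr
    rw [inv_pow, ← div_eq_mul_inv]
    exact div_le_one_of_le₀ this (by positivity)
  have h3 : 0 ≤ w ^ r * ((r - 1).choose p * (a ^ (r - 1 - p) * b)) := by positivity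
  rw [abs_mul, abs_of_nonneg h3]
  calc _ ≤ w ^ r * ((r - 1).choose p * (a ^ (r - 1 - p) * b)) * (C p * s⁻¹ ^ (r - p)) := by gcongr
    _ = w ^ r * ((r - 1).choose p * C p) * (a ^ (r - 1 - p) * b * s⁻¹ ^ (r - p)) := by ring
    _ ≤ w ^ r * ((r - 1).choose p * C p) * 1 := by
        have := hC p
        gcongr
    _ = _ := by ring

/-- The same splitting in the other variable. The polynomial factor is now linear in `l`, so it is
annihilated because `r > 1`, and only the powers `p = 0, 1` occur. -/
theorem exists_seqDiff_log_snd_bound (hr : 1 < r) :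
    ∃ C, 0 ≤ C ∧ ∀ w a b : ℝ, 0 < w → 0 ≤ a → 0 ≤ b → 1 ≤ a + b →
      |seqDiff r (fun l => (w * a) ^ (r - 1) * (w * (b + l)) * Real.log (w * (a + b + l)))|
        ≤ C * w ^ r := by
  obtain ⟨C₀, hC₀, h₀⟩ := exists_seqDiff_pow_mul_log_bound (show 0 < r by omega)
  obtain ⟨C₁, hC₁, h₁⟩ := exists_seqDiff_pow_mul_log_bound hr
  refine ⟨C₀ + C₁, by positivity, fun w a b hw ha hb hab => ?_⟩
  set s := a + b with hs
  have hs0 : 0 < s := by linarith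
  have hpoly : seqDiff r (fun l => (w * a) ^ (r - 1) * (w * (b + l)) * Real.log (w * s)) = 0 := by
    have hd : (Polynomial.X * Polynomial.C ((w * a) ^ (r - 1) * Real.log (w * s))).natDegree < r := by
      refine lt_of_le_of_lt (Polynomial.natDegree_mul_C_le _ _) ?_
      rw [Polynomial.natDegree_X]; omega
    rw [← seqDiff_eval hd (w * b) w]
    congr 1
    ext l
    simp only [Polynomial.eval_mul, Polynomial.eval_X, Polynomial.eval_C]
    ring
  have e : seqDiff r (fun l => (w * a) ^ (r - 1) * (w * (b + l)) * Real.log (w * (s + l)))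
      = (w ^ r * (a ^ (r - 1) * b)) * seqDiff r (fun l => (l : ℝ) ^ 0 * Real.log (1 + l * s⁻¹))
        + (w ^ r * a ^ (r - 1)) * seqDiff r (fun l => (l : ℝ) ^ 1 * Real.log (1 + l * s⁻¹)) := by
    rw [← sub_zero (seqDiff r (fun l => (w * a) ^ (r - 1) * (w * (b + l)) * Real.log (w * (s + l)))),
      ← hpoly, ← seqDiff_sub, ← seqDiff_const_mul, ← seqDiff_const_mul, ← seqDiff_add]
    congr 1
    ext l
    rw [log_scaled_add hw hs0 (by positivity), mul_add, add_sub_cancel_left, mul_pow]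
    have : w ^ r = w ^ (r - 1) * w := by rw [← pow_succ, show r - 1 + 1 = r by omega]
    rw [this]
    ring
  have hu := inv_le_one_of_one_le₀ hab
  have h2 := h₀ s⁻¹ (by positivity) hu
  have h3 := h₁ s⁻¹ (by positivity) hu
  have has : a ≤ s := by linarith
  have hbs : b ≤ s := by linarith
  have h4 : a ^ (r - 1) * b * s⁻¹ ^ (r - 0) ≤ 1 := by
    rw [inv_pow, ← div_eq_mul_inv]
    refine div_le_one_of_le₀ ?_ (by positivity)
    rw [show r - 0 = r - 1 + 1 by omega, pow_succ]
    gcongr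
  have h5 : a ^ (r - 1) * s⁻¹ ^ (r - 1) ≤ 1 := by
    rw [inv_pow, ← div_eq_mul_inv]
    exact div_le_one_of_le₀ (by gcongr) (by positivity)
  rw [e]
  refine (abs_add_le _ _).trans ?_
  rw [add_mul]
  refine add_le_add ?_ ?_
  · rw [abs_mul, abs_of_nonneg (show 0 ≤ w ^ r * (a ^ (r - 1) * b) by positivity)]
    calc _ ≤ w ^ r * (a ^ (r - 1) * b) * (C₀ * s⁻¹ ^ (r - 0)) := by gcongr
      _ = C₀ * w ^ r * (a ^ (r - 1) * b * s⁻¹ ^ (r - 0)) := by ring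
      _ ≤ C₀ * w ^ r * 1 := by gcongr
      _ = _ := by ring
  · rw [abs_mul, abs_of_nonneg (show 0 ≤ w ^ r * a ^ (r - 1) by positivity)]
    calc _ ≤ w ^ r * a ^ (r - 1) * (C₁ * s⁻¹ ^ (r - 1)) := by gcongr
      _ = C₁ * w ^ r * (a ^ (r - 1) * s⁻¹ ^ (r - 1)) := by ring
      _ ≤ C₁ * w ^ r * 1 := by gcongr
      _ = _ := by ring

/-- `x₀^(r-1) x₁ log (x₀ + x₁)`: its `r`-th coordinate derivatives are bounded on the cube, its
mixed derivative of order `(r-1, 1)` has a logarithmic singularity. -/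
noncomputable def logExample (r : ℕ) (i₀ i₁ : Fin d) : Space d → ℝ :=
  fun x => x i₀ ^ (r - 1) * x i₁ * Real.log (x i₀ + x i₁)

theorem continuousOn_logExample (r : ℕ) (i₀ i₁ : Fin d) :
    ContinuousOn (logExample r i₀ i₁) (cube d) := by
  intro x _
  by_cases hs : x i₀ + x i₁ = 0
  · have hfx : logExample r i₀ i₁ x = 0 := by
      simp [logExample, hs]
    rw [ContinuousWithinAt, hfx]
    -- On the cube the example is dominated by `|s log s|` with `s = x₀ + x₁`, which tends to `0`
    -- with `s`.
    have hlim : Tendsto (fun y : Space d => |(y i₀ + y i₁) * Real.log (y i₀ + y i₁)|)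
        (𝓝[cube d] x) (𝓝 0) := by
      have hc : Continuous fun y : Space d => |(y i₀ + y i₁) * Real.log (y i₀ + y i₁)| :=
        (Real.continuous_mul_log.comp (by fun_prop : Continuous fun y : Space d => y i₀ + y i₁)).abs
      have := (hc.tendsto x).mono_left (nhdsWithin_le_nhds (s := cube d))
      simpa [hs] using this
    refine squeeze_zero_norm' ?_ hlim
    filter_upwards [self_mem_nhdsWithin] with y hy
    have hy0 := hy i₀
    have hy1 := hy i₁
    rw [logExample, Real.norm_eq_abs, abs_mul (y i₀ ^ (r - 1) * y i₁), abs_mul (y i₀ + y i₁)]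
    refine mul_le_mul_of_nonneg_right ?_ (abs_nonneg _)
    rw [abs_of_nonneg (mul_nonneg (pow_nonneg hy0.1 _) hy1.1),
      abs_of_nonneg (add_nonneg hy0.1 hy1.1)]
    exact (mul_le_of_le_one_left hy1.1 (pow_le_one₀ hy0.1 hy0.2)).trans (by linarith [hy0.1])
  · refine ContinuousAt.continuousWithinAt ?_
    unfold logExample
    refine ContinuousAt.mul (by fun_prop) (ContinuousAt.log (by fun_prop) hs)

theorem seqDiff_const (hr : 0 < r) (c : ℝ) : seqDiff r (fun _ => c) = 0 := by
  have := seqDiff_eval (p := Polynomial.C c) (by simpa using hr) 0 0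
  simpa using this

theorem exists_logExample_mesh_bound (hr : 1 < r) {i₀ i₁ : Fin d} (hi : i₀ ≠ i₁) :
    ∃ C, 0 ≤ C ∧ ∀ (n : ℕ) (i : Fin d) (k : Fin d → ℤ), (∀ j, 0 ≤ k j) →
      |seqDiff r (fun l => inCoords (logExample r i₀ i₁)
        (mesh n k + (l : ℝ) • Pi.single i (width n)))| ≤ C * width n ^ r := by
  obtain ⟨C₀, hC₀, h₀⟩ := exists_seqDiff_log_fst_bound hr
  obtain ⟨C₁, hC₁, h₁⟩ := exists_seqDiff_log_snd_bound hr
  refine ⟨C₀ + C₁, by positivity, fun n i k hk => ?_⟩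
  have hw := width_pos n
  have ha : (0 : ℝ) ≤ k i₀ := by exact_mod_cast hk i₀
  have hb : (0 : ℝ) ≤ k i₁ := by exact_mod_cast hk i₁
  have hB0 : C₀ * width n ^ r ≤ (C₀ + C₁) * width n ^ r := by gcongr; linarith
  have hB1 : C₁ * width n ^ r ≤ (C₀ + C₁) * width n ^ r := by gcongr; linarith
  have hz : (0 : ℝ) ≤ (C₀ + C₁) * width n ^ r := by positivity
  by_cases hi0 : i = i₀
  · subst hi0
    have e : (fun l : ℕ => inCoords (logExample r i i₁)
        (mesh n k + (l : ℝ) • Pi.single i (width n)))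
        = fun l : ℕ => (width n * (k i + l)) ^ (r - 1) * (width n * k i₁) *
          Real.log (width n * (k i + k i₁ + l)) := by
      ext l
      simp only [inCoords, logExample, mesh, Pi.add_apply, Pi.smul_apply, Pi.single_eq_same,
        Pi.single_eq_of_ne hi.symm, smul_eq_mul, mul_zero, add_zero]
      ring_nf
    rw [e]
    -- Otherwise both indices are `0`, and the example vanishes identically along the axis through
    -- the singular point; the same happens in the other direction below, where `r - 1 ≠ 0` is
    -- needed.
    by_cases hs : 1 ≤ k i + k i₁
    · exact (h₀ _ _ _ hw ha hb (by exact_mod_cast hs)).trans hB0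
    · have : k i₁ = 0 := by have := hk i; have := hk i₁; omega
      simp only [this, Int.cast_zero, mul_zero, zero_mul]
      rw [seqDiff_const (by omega), abs_zero]
      exact hz
  by_cases hi1 : i = i₁
  · subst hi1
    have e : (fun l : ℕ => inCoords (logExample r i₀ i)
        (mesh n k + (l : ℝ) • Pi.single i (width n)))
        = fun l : ℕ => (width n * k i₀) ^ (r - 1) * (width n * (k i + l)) *
          Real.log (width n * (k i₀ + k i + l)) := by
      ext l
      simp only [inCoords, logExample, mesh, Pi.add_apply, Pi.smul_apply, Pi.single_eq_same,
        Pi.single_eq_of_ne hi, smul_eq_mul, mul_zero, add_zero]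
      ring_nf
    rw [e]
    by_cases hs : 1 ≤ k i₀ + k i
    · exact (h₁ _ _ _ hw ha hb (by exact_mod_cast hs)).trans hB1
    · have : k i₀ = 0 := by have := hk i; have := hk i₀; omega
      have hr0 : r - 1 ≠ 0 := by omega
      simp only [this, Int.cast_zero, mul_zero, zero_mul, zero_pow hr0]
      rw [seqDiff_const (by omega), abs_zero]
      exact hz
  · have e : (fun l : ℕ => inCoords (logExample r i₀ i₁)
        (mesh n k + (l : ℝ) • Pi.single i (width n)))
        = fun l : ℕ => inCoords (logExample r i₀ i₁) (mesh n k) := by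
      ext l
      simp [inCoords, logExample, Pi.single_eq_of_ne (Ne.symm hi0), Pi.single_eq_of_ne (Ne.symm hi1)]
    rw [e, seqDiff_const (by omega), abs_zero]
    exact hz

theorem isBigO_discreteModulus_logExample (hr : 1 < r) {i₀ i₁ : Fin d} (hi : i₀ ≠ i₁) :
    (fun n : ℕ => discreteModulus r (logExample r i₀ i₁) n)
      =O[atTop] (fun n : ℕ => (2 : ℝ) ^ (-((n : ℝ) * (r : ℝ)))) := by
  obtain ⟨C, hC, h⟩ := exists_logExample_mesh_bound hr hi
  refine IsBigO.of_bound C (Eventually.of_forall fun n => ?_)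
  rw [two_rpow_neg_mul, ← width_rpow, Real.rpow_natCast, Real.norm_eq_abs, Real.norm_eq_abs,
    abs_of_pos (pow_pos (width_pos n) r), abs_of_nonneg]
  · refine Real.sSup_le ?_ (mul_nonneg hC (pow_pos (width_pos n) r).le)
    rintro v ⟨i, k, hk, -, rfl⟩
    rw [diff_width_eq]
    exact h n i k fun j => (meshPoint_mem_cube.1 hk j).1
  · refine Real.sSup_nonneg ?_
    rintro v ⟨i, k, -, -, rfl⟩
    exact abs_nonneg _

/-! ### The exact order `t^r |log t|`. -/

/-- In the limiting case `α = r` the modulus is at most of order `t^r |log t|`. -/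
theorem isBigO_modulus_log (hr : 0 < r) {f : Space d → ℝ} (hf : ContinuousOn f (cube d))
    (h : (fun n : ℕ => discreteModulus r f n)
      =O[atTop] (fun n : ℕ => (2 : ℝ) ^ (-((n : ℝ) * (r : ℝ))))) :
    (fun t : ℝ => modulus r f t) =O[𝓝[>] (0 : ℝ)] (fun t : ℝ => t ^ r * |Real.log t|) := by
  obtain ⟨K, hK, N, hD⟩ := exists_dyadicBound_of_isBigO hf h
  obtain ⟨N', hNN', hN'⟩ := exists_le_two_pow r N
  have hF := continuousOn_inCoords hf
  obtain ⟨S, hS0, hS⟩ := exists_bound_on_unitBox hF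
  have hr0 : (0 : ℝ) < r := by exact_mod_cast hr
  obtain ⟨C, hC, hb⟩ := exists_seqDiff_bound hr hF hN' hK (by positivity)
    (two_rpow_neg_lt_one hr0) (hD.mono hNN') hS
  have hlog2 : 0 < Real.log 2 := Real.log_pos (by norm_num)
  refine IsBigO.of_bound (C * 2 ^ r * (3 / Real.log 2)) ?_
  have hev : Set.Ioo (0 : ℝ) (min (width N') (1 / 2)) ∈ 𝓝[>] (0 : ℝ) :=
    Ioo_mem_nhdsGT (lt_min (width_pos N') (by norm_num))
  filter_upwards [hev] with t ht
  have ht0 : 0 < t := ht.1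
  have ht2 : t < 1 / 2 := ht.2.trans_le (min_le_right _ _)
  obtain ⟨m, hm, htm, hmt⟩ := exists_width_near ht0 (ht.2.trans_le (min_le_left _ _)).le
  have hL : |Real.log t| = -Real.log t := abs_of_neg (Real.log_neg ht0 (by linarith))
  have hL2 : Real.log 2 ≤ |Real.log t| := by
    rw [hL, ← Real.log_inv]
    refine Real.log_le_log (by norm_num) ?_
    rw [le_inv_comm₀ (by norm_num) ht0]
    linarith
  have hLm : m * Real.log 2 ≤ |Real.log t| := by
    have := Real.log_le_log ht0 htm
    rw [width, Real.log_pow, Real.log_inv] at this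
    rw [hL]
    linarith
  -- The number of levels up to scale `t` is of order `|log t|`; the restriction `t < 1/2` absorbs
  -- the additive `2`.
  have hm2 : (m : ℝ) + 2 ≤ 3 / Real.log 2 * |Real.log t| := by
    rw [div_mul_eq_mul_div, le_div_iff₀ hlog2]
    linarith
  have hρ : (2 : ℝ) ^ r * 2 ^ (-(r : ℝ)) = 1 := by
    rw [← Real.rpow_natCast, ← Real.rpow_add (by norm_num)]; simp
  have hwr : width m ^ r ≤ 2 ^ r * t ^ r := by
    rw [← mul_pow]
    exact pow_le_pow_left₀ (width_pos m).le hmt.le r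
  have hw := width_pos m
  -- Here `2^r ρ = 1`, so the sum equals `m + 1`, and `ρ^m = width m ^ r` adds one more.
  have hmod : modulus r f t ≤ C * (width m ^ r * ((m : ℝ) + 2)) := by
    refine modulus_le_of_forall (by positivity) fun h x hh hx hxh => ?_
    refine (hb m hm x h hx hxh fun j => (hh j).trans htm).trans (le_of_eq ?_)
    rw [hρ, ← width_rpow, Real.rpow_natCast]
    simp only [one_pow, Finset.sum_const, Finset.card_range, nsmul_eq_mul, mul_one]
    push_cast
    ring
  have hnn : 0 ≤ modulus r f t := by
    refine Real.sSup_nonneg ?_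
    rintro v ⟨h, x, -, -, -, rfl⟩
    exact abs_nonneg _
  rw [Real.norm_eq_abs, Real.norm_eq_abs, abs_of_nonneg hnn,
    abs_of_nonneg (by positivity : 0 ≤ t ^ r * |Real.log t|)]
  calc modulus r f t ≤ C * (width m ^ r * ((m : ℝ) + 2)) := hmod
    _ ≤ C * ((2 ^ r * t ^ r) * (3 / Real.log 2 * |Real.log t|)) := by gcongr
    _ = _ := by ring

theorem seqDiff_pow_self (r : ℕ) : seqDiff r (fun k => (k : ℝ) ^ r) = (r.factorial : ℝ) := by
  have h := congrFun (fwdDiff_iter_eq_factorial (R := ℝ) (n := r)) 0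
  rw [fwdDiff_iter_eq_sum_shift] at h
  refine Eq.trans (Finset.sum_congr rfl fun k _ => ?_) h
  rw [zsmul_eq_mul]
  simp

/-- Take the difference at the origin with step `(t/2)(e₀ + e₁)`. The values are `(t/2)^r k^r (log t
+ log k)`, and the `r`-th difference of `k^r` is `r!`, which leaves `(t/2)^r (r! log t + A)` with
`A` independent of `t`. -/
theorem isBigO_log_modulus_logExample (hr : 1 < r) {i₀ i₁ : Fin d} (hi : i₀ ≠ i₁) :
    (fun t : ℝ => t ^ r * |Real.log t|)
      =O[𝓝[>] (0 : ℝ)] (fun t : ℝ => modulus r (logExample r i₀ i₁) t) := by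
  obtain ⟨S, hS0, hS⟩ := exists_bound_on_unitBox
    (continuousOn_inCoords (continuousOn_logExample r i₀ i₁))
  set A := seqDiff r (fun k => (k : ℝ) ^ r * Real.log k) with hA
  refine IsBigO.of_bound (2 * 2 ^ r) ?_
  have hr0 : (0 : ℝ) < r := by exact_mod_cast (by omega : 0 < r)
  -- `r t ≤ 1` keeps the segment in the cube, and `|log t| ≥ 2 |A|` lets the logarithm dominate the
  -- constant.
  filter_upwards [Ioo_mem_nhdsGT (lt_min one_pos (inv_pos.2 hr0)),
    Real.tendsto_log_nhdsGT_zero.eventually_le_atBot (-(2 * |A|))] with t ht htlog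
  have ht0 : 0 < t := ht.1
  have ht1 : t < 1 := ht.2.trans_le (min_le_left _ _)
  have htr : r * t ≤ 1 := by
    have := (ht.2.trans_le (min_le_right _ _)).le
    calc r * t ≤ r * (r : ℝ)⁻¹ := by gcongr
      _ = 1 := mul_inv_cancel₀ hr0.ne'
  have hL : |Real.log t| = -Real.log t := abs_of_neg (Real.log_neg ht0 ht1)
  set h : Space d := (t / 2) • unitVec i₀ + (t / 2) • unitVec i₁ with hh
  have hh0 : h i₀ = t / 2 := by simp [hh, unitVec, hi]
  have hh1 : h i₁ = t / 2 := by simp [hh, unitVec, hi.symm]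
  have hhj : ∀ j, 0 ≤ h j ∧ h j ≤ t := by
    intro j
    by_cases hj0 : j = i₀
    · subst hj0; rw [hh0]; constructor <;> linarith
    by_cases hj1 : j = i₁
    · subst hj1; rw [hh1]; constructor <;> linarith
    · have : h j = 0 := by simp [hh, unitVec, hj0, hj1]
      rw [this]; exact ⟨le_rfl, ht0.le⟩
  have hnorm : ‖h‖ ≤ t := by
    refine (norm_add_le _ _).trans ?_
    rw [norm_smul, norm_smul, norm_unitVec, norm_unitVec, Real.norm_eq_abs,
      abs_of_pos (by positivity)]
    linarith
  have h0mem : (0 : Space d) ∈ cube d := fun j => by simp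
  have hmem : (0 : Space d) + (r : ℝ) • h ∈ cube d := by
    intro j
    have e : ((0 : Space d) + (r : ℝ) • h) j = r * h j := by simp
    rw [e]
    exact ⟨mul_nonneg hr0.le (hhj j).1, (mul_le_mul_of_nonneg_left (hhj j).2 hr0.le).trans htr⟩
  have hval : diff r h (logExample r i₀ i₁) 0 = (t / 2) ^ r * (r.factorial * Real.log t + A) := by
    have : diff r h (logExample r i₀ i₁) 0 = seqDiff r (fun k => (t / 2) ^ r *
        (Real.log t * (k : ℝ) ^ r + (k : ℝ) ^ r * Real.log k)) := by
      refine Finset.sum_congr rfl fun k _ => ?_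
      congr 1
      have e : ∀ i, ((0 : Space d) + (k : ℝ) • h) i = k * h i := fun i => by simp
      rw [logExample, e, e, hh0, hh1]
      rcases Nat.eq_zero_or_pos k with rfl | hk
      · simp [show r ≠ 0 by omega]
      · have hk' : (0 : ℝ) < k := by exact_mod_cast hk
        rw [← pow_succ, show r - 1 + 1 = r by omega,
          show (k : ℝ) * (t / 2) + k * (t / 2) = t * k by ring,
          Real.log_mul ht0.ne' hk'.ne', mul_pow]
        ring
    rw [this, seqDiff_const_mul, seqDiff_add, seqDiff_const_mul, seqDiff_pow_self]
    ring
  have hle : |diff r h (logExample r i₀ i₁) 0| ≤ modulus r (logExample r i₀ i₁) t := by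
    refine le_csSup ⟨2 ^ r * S, ?_⟩ ⟨h, 0, hnorm, h0mem, hmem, rfl⟩
    rintro v ⟨h, x, -, hx, hxh, rfl⟩
    exact abs_seqDiff_le_of_mem hS hx hxh
  have hfac : (1 : ℝ) ≤ r.factorial := by exact_mod_cast r.factorial_pos
  have hlow : |Real.log t| / 2 ≤ |r.factorial * Real.log t + A| := by
    rw [hL]
    have h1 : -(r.factorial * Real.log t + A) ≤ |r.factorial * Real.log t + A| := neg_le_abs _
    have h2 := le_abs_self A
    have h3 := abs_nonneg A
    nlinarith
  rw [Real.norm_eq_abs, Real.norm_eq_abs, abs_of_nonneg (by positivity : 0 ≤ t ^ r * |Real.log t|)]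
  refine le_trans ?_ (mul_le_mul_of_nonneg_left (hle.trans (le_abs_self _)) (by positivity))
  rw [hval, abs_mul, abs_of_pos (by positivity : 0 < (t / 2) ^ r)]
  calc t ^ r * |Real.log t| = 2 * 2 ^ r * ((t / 2) ^ r * (|Real.log t| / 2)) := by
        rw [div_pow]; field_simp
    _ ≤ _ := by gcongr

end DyadicSmoothness

/-! ### Assembly of the five statements. -/

theorem mainTheorem3 (d r : ℕ) :
    -- directional differences, `0 < α ≤ r`
    (∀ f : DyadicSmoothness.Space d → ℝ, ContinuousOn f (DyadicSmoothness.cube d) →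
      ∀ α : ℝ, 0 < α → α ≤ (r : ℝ) →
      (fun n : ℕ => DyadicSmoothness.discreteModulus r f n)
        =O[atTop] (fun n : ℕ => (2 : ℝ) ^ (-((n : ℝ) * α))) →
      ∃ M : ℝ, ∀ (i : Fin d) (t : ℝ) (x : DyadicSmoothness.Space d), 0 < t →
        x ∈ DyadicSmoothness.cube d →
        x + ((r : ℝ) * t) • DyadicSmoothness.unitVec i ∈ DyadicSmoothness.cube d →
        |DyadicSmoothness.diff r (t • DyadicSmoothness.unitVec i) f x| ≤ M * t ^ α) ∧
    -- the modulus of smoothness, `0 < α < r`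
    (∀ f : DyadicSmoothness.Space d → ℝ, ContinuousOn f (DyadicSmoothness.cube d) →
      ∀ α : ℝ, 0 < α → α < (r : ℝ) →
      (fun n : ℕ => DyadicSmoothness.discreteModulus r f n)
        =O[atTop] (fun n : ℕ => (2 : ℝ) ^ (-((n : ℝ) * α))) →
      ∃ M : ℝ, ∀ t : ℝ, 0 < t → DyadicSmoothness.modulus r f t ≤ M * t ^ α) ∧
    -- sharpness: for `α = r`, `d > 1`, `r > 1` the modulus may behave like `t^r |log t|`
    (1 < d → 1 < r →
      ∃ f : DyadicSmoothness.Space d → ℝ, ContinuousOn f (DyadicSmoothness.cube d) ∧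
        (fun n : ℕ => DyadicSmoothness.discreteModulus r f n)
          =O[atTop] (fun n : ℕ => (2 : ℝ) ^ (-((n : ℝ) * (r : ℝ)))) ∧
        (fun t : ℝ => DyadicSmoothness.modulus r f t)
          =Θ[𝓝[>] (0 : ℝ)] (fun t : ℝ => t ^ r * |Real.log t|)) ∧
    -- the case `r = 1`, `0 < α ≤ 1`
    (∀ f : DyadicSmoothness.Space d → ℝ, ContinuousOn f (DyadicSmoothness.cube d) →
      ∀ α : ℝ, 0 < α → α ≤ 1 →
      (fun n : ℕ => DyadicSmoothness.discreteModulus 1 f n)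
        =O[atTop] (fun n : ℕ => (2 : ℝ) ^ (-((n : ℝ) * α))) →
      ∃ M : ℝ, ∀ t : ℝ, 0 < t → DyadicSmoothness.modulus 1 f t ≤ M * t ^ α) ∧
    -- the equivalence of the discrete and the continuous Lipschitz condition
    (∀ f : DyadicSmoothness.Space d → ℝ, ContinuousOn f (DyadicSmoothness.cube d) →
      ∀ α : ℝ, 0 < α → (α < (r : ℝ) ∨ (r = 1 ∧ α ≤ 1)) →
      ((∃ M : ℝ, ∀ n : ℕ, 1 ≤ n → ∀ (i : Fin d) (k : Fin d → ℤ),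
          0 ≤ k i → k i ≤ (2 : ℤ) ^ n - (r : ℤ) →
          (∀ j, j ≠ i → 0 ≤ k j ∧ k j ≤ (2 : ℤ) ^ n) →
          |DyadicSmoothness.diff r (DyadicSmoothness.width n • DyadicSmoothness.unitVec i) f
            (DyadicSmoothness.meshPoint n k)| ≤ M * (2 : ℝ) ^ (-((n : ℝ) * α))) ↔
        ∃ M₁ : ℝ, ∀ (ξ e : DyadicSmoothness.Space d) (h : ℝ), 0 < h → ‖e‖ = 1 →
          ξ ∈ DyadicSmoothness.cube d → ξ + ((r : ℝ) * h) • e ∈ DyadicSmoothness.cube d →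
          |DyadicSmoothness.diff r (h • e) f ξ| ≤ M₁ * h ^ α)) := by
  refine ⟨fun f hf α hα hαr h => ?_, fun f hf α hα hαr h => ?_, fun hd hr => ?_,
    fun f hf α hα hα1 h => ?_, fun f hf α hα hαr => ?_⟩
  · have hr : 0 < r := by exact_mod_cast hα.trans_le hαr
    obtain ⟨K, hK, N, hD⟩ := DyadicSmoothness.exists_dyadicBound_of_isBigO hf h
    obtain ⟨M, -, hM⟩ := DyadicSmoothness.exists_directional_bound hr
      (DyadicSmoothness.continuousOn_inCoords hf) hK hα hD
    refine ⟨M, fun i t x ht hx hxt => ?_⟩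
    rw [DyadicSmoothness.add_mul_smul_mem_iff, DyadicSmoothness.ofLp_smul_unitVec] at hxt
    rw [DyadicSmoothness.diff_eq_seqDiff, DyadicSmoothness.ofLp_smul_unitVec]
    exact hM i t _ ht hx hxt
  · have hr : 0 < r := by exact_mod_cast hα.trans hαr
    exact DyadicSmoothness.modulus_le_rpow hr hf hα (Or.inl hαr) h
  · have hi : (⟨0, by omega⟩ : Fin d) ≠ ⟨1, hd⟩ := by simp
    have hf := DyadicSmoothness.continuousOn_logExample r (⟨0, by omega⟩ : Fin d) ⟨1, hd⟩
    have hΨ := DyadicSmoothness.isBigO_discreteModulus_logExample hr hi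
    exact ⟨_, hf, hΨ, DyadicSmoothness.isBigO_modulus_log (by omega) hf hΨ,
      DyadicSmoothness.isBigO_log_modulus_logExample hr hi⟩
  · exact DyadicSmoothness.modulus_le_rpow one_pos hf hα (Or.inr rfl) h
  · have hr : 0 < r := by
      rcases hαr with hαr | hαr
      · exact_mod_cast hα.trans hαr
      · omega
    exact DyadicSmoothness.exists_unit_direction_bound_iff hr hf hα (hαr.imp_right And.left)
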